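/- Let $(0,0)=p_0,p_1,\dots,p_m=(1,1)$ be the consecutive vertices of a strictly convex polygonal curve in $[0,1]^2$, with strictly increasing abscissae and strictly increasing slopes (the known points of a Lorenz curve). Consider all convex curves through $p_0,\dots,p_m$, i.e. graphs of convex functions $L:[0,1]\to[0,\infty)$ with $L(0)=0$, $L(1)=1$ that pass through all $p_i$ (a jump of $L$ at $1$ is allowed and is regarded as a vertical segment of the curve on the line $x=1$). Such a curve is called *optimal* if its Gini coefficient $\mathcal G(L)=2\int_0^1 (x-L(x))\,dx$, twice the area between the diagonal and the curve, is maximal among all these curves. The side $S_i=p_ip_{i+1}$ is *used* (U) by the curve if it is contained in the curve, and *not used* (N) otherwise; this assigns to the curve a sequence in $\{U,N\}^m$. Farris conjectured that for all such points the maximum is attained at a convex polygonal curve each of whose sides lies on one of the lines $p_ip_{i+1}$ (apart from sides lying on the sides $y=0$ and $x=1$ of the unit square); equivalently, at a convex polygonal curve whose sequence contains no two consecutive $N$s. Both forms of the conjecture are false. Specifically, let $n\ge 5$ with $8\mid n-4$, and consider the regular $n$-gon centered at $(0,1)$ with a vertex at $(0,0)$. Its vertices in $[0,1]^2$ are $p_k=\left(\sin\frac{2\pi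 k}{n},\,1-\cos\frac{2\pi k}{n}\right)$, $0\le k\le n/4$; they satisfy the above conditions. For these points an optimal curve exists, and every optimal curve is polygonal and uses none of the sides $S_i$; in particular its sequence contains two consecutive $N$s, and it has a side which lies neither on a line $p_ip_{i+1}$ nor on a side of the unit square. -/

import Mathlib

open Set

noncomputable section

/-- A convex curve in the unit square joining `(0,0)` to `(1,1)`, given as the graph over `[0,1]` of a
nonnegative convex function `L` with `L 0 = 0` and `L 1 = 1`. (Such an `L` takes values in `[0,1]`, is
nondecreasing, and is continuous except possibly at `1`; a jump at `1` is a vertical last segment of the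
curve, on the side `x = 1` of the square.) Values outside `[0,1]` are irrelevant. -/
structure IsLorenzCurve (L : ℝ → ℝ) : Prop where
  convexOn : ConvexOn ℝ (Icc 0 1) L
  nonneg : ∀ x ∈ Icc (0 : ℝ) 1, 0 ≤ L x
  map_zero : L 0 = 0
  map_one : L 1 = 1

/-- The Gini coefficient: twice the area between the neutral line and the curve. -/
def gini (L : ℝ → ℝ) : ℝ := 2 * ∫ x in (0 : ℝ)..1, (x - L x)

/-- The slope of the `i`-th side `p i, p (i+1)` of the polygonal curve with vertices `p`. -/
def sideSlope {m : ℕ} (p : Fin (m + 1) → ℝ × ℝ) (i : Fin m) : ℝ :=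
  ((p i.succ).2 - (p i.castSucc).2) / ((p i.succ).1 - (p i.castSucc).1)

/-- Finitely many given points of a Lorenz curve, from `(0,0)` to `(1,1)`: the vertices, in order, of a
strictly convex polygonal curve. -/
structure IsLorenzData {m : ℕ} (p : Fin (m + 1) → ℝ × ℝ) : Prop where
  first : p 0 = (0, 0)
  last : p (Fin.last m) = (1, 1)
  nonneg : ∀ i, 0 ≤ (p i).2
  strictMono_fst : StrictMono fun i => (p i).1
  strictMono_slope : StrictMono (sideSlope p)

/-- `L` is a convex curve through all the given points. -/
def IsCircumscribed {m : ℕ} (p : Fin (m + 1) → ℝ × ℝ) (L : ℝ → ℝ) : Prop :=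
  IsLorenzCurve L ∧ ∀ i, L (p i).1 = (p i).2

/-- `L` has the largest Gini coefficient (equivalently, encloses the largest area with the neutral
line) among all convex curves through the given points. -/
def IsOptimal {m : ℕ} (p : Fin (m + 1) → ℝ × ℝ) (L : ℝ → ℝ) : Prop :=
  IsCircumscribed p L ∧ ∀ M : ℝ → ℝ, IsCircumscribed p M → gini M ≤ gini L

/-- The curve consists of finitely many straight segments (besides a possible vertical one at
`x = 1`). -/
def IsPolygonal (L : ℝ → ℝ) : Prop :=
  ∃ (N : ℕ) (t : ℕ → ℝ), t 0 = 0 ∧ t N = 1 ∧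
    ∀ j < N, t j < t (j + 1) ∧
      ∃ s c : ℝ, ∀ x ∈ Ioo (t j) (t (j + 1)), L x = s * x + c

/-- The `i`-th side of the polygonal curve with vertices `p` is used by `L` (letter `U`): it is
contained in the curve. Otherwise it is not used (letter `N`). -/
def Used {m : ℕ} (p : Fin (m + 1) → ℝ × ℝ) (L : ℝ → ℝ) (i : Fin m) : Prop :=
  segment ℝ (p i.castSucc) (p i.succ) ⊆ {z : ℝ × ℝ | z.2 = L z.1}

/-- The sequence of `U`s and `N`s assigned to `L` contains two consecutive `N`s. -/
def HasConsecutiveN {m : ℕ} (p : Fin (m + 1) → ℝ × ℝ) (L : ℝ → ℝ) : Prop :=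
  ∃ i j : Fin m, (j : ℕ) = (i : ℕ) + 1 ∧ ¬ Used p L i ∧ ¬ Used p L j

/-- Each side of the curve `L` lies on a sideline of the polygonal curve with vertices `p` or on a side
of the unit square: whenever `L` is given by `y = s x + c` on a nondegenerate interval, the line
`y = s x + c` is the `x`-axis or passes through two consecutive points of `p`. (A vertical last side
lies on the side `x = 1` of the square.) -/
def SidesOnSidelines {m : ℕ} (p : Fin (m + 1) → ℝ × ℝ) (L : ℝ → ℝ) : Prop :=
  ∀ a b s c : ℝ, 0 ≤ a → a < b → b ≤ 1 → (∀ x ∈ Ioo a b, L x = s * x + c) →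
    (s = 0 ∧ c = 0) ∨
    ∃ i : Fin m, (p i.castSucc).2 = s * (p i.castSucc).1 + c ∧ (p i.succ).2 = s * (p i.succ).1 + c

/-- Farris' conjecture, in terms of sidelines: the maximal value is attained at a convex polygonal
curve each side of which lies on a sideline of the polygonal curve connecting the given points. -/
def FarrisConjectureSidelines : Prop :=
  ∀ (m : ℕ) (p : Fin (m + 1) → ℝ × ℝ), IsLorenzData p →
    ∃ L : ℝ → ℝ, IsOptimal p L ∧ IsPolygonal L ∧ SidesOnSidelines p L

/-- Farris' conjecture, in terms of sequences: the maximal value is attained at a convex polygonal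
curve whose sequence of `U`s and `N`s has no two consecutive `N`s. -/
def FarrisConjectureSequences : Prop :=
  ∀ (m : ℕ) (p : Fin (m + 1) → ℝ × ℝ), IsLorenzData p →
    ∃ L : ℝ → ℝ, IsOptimal p L ∧ IsPolygonal L ∧ ¬ HasConsecutiveN p L

/-- The vertices, in counterclockwise order, of the regular `n`-gon with center `(0,1)` and the vertex
`(0,0)`, starting from `(0,0)`. -/
def regularVertex (n k : ℕ) : ℝ × ℝ :=
  (Real.sin (2 * Real.pi * k / n), 1 - Real.cos (2 * Real.pi * k / n))

/-- The first `n / 4 + 1` vertices of that polygon. For `4 ∣ n` they are those in the unit square. -/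
def regularArc (n : ℕ) (k : Fin (n / 4 + 1)) : ℝ × ℝ := regularVertex n k

end

/-! The given points lie on the unit circle about (0, 1); put m = n / 4 and η = π / n. The unique
optimum is the upper envelope of the tangents to the circle at these points, closed by a vertical
segment on x = 1. It contains no chord, and its side on the tangent at p_1 has only p_1 in common
with the given points. So both forms of the conjecture fail, already for n = 12.

For optimality, take any convex curve through the points and a supporting line at each p_i, and
write w_i tan η for the tangent of its angle with the circle's tangent there. The adjacent chords
force |w_i| ≤ 1, and the sides y = 0 and x = 1 of the square allow w_0 = w_m = 0
(`exists_supporting_directions`). Over each side the region between chord and curve lies in the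
triangle cut off by the two supporting lines. Its area is a fixed multiple of `triangleArea e w_i
w_{i+1}` with e = tan² η (`integral_ge_side`). Everything thus reduces to `sum_triangleArea`: the
sum over the m sides is at most m / 2, with equality only for w = 0.

A single triangle can exceed 1/2, so the sides are coupled by a calibration Φ_i = w_i / 2 + κ_i
w_i². Each summand is at most 1/2 - (1 + e) / 2 * (Φ_i - Φ_{i+1}), and the corrections telescope to
zero. The linear part of Φ is dictated by the derivative of `triangleArea` at 0. The quadratic part
works if κ satisfies a discrete Riccati inequality, roughly κ_{i+1} - κ_i > 8 κ² + e with κ the mean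
of the two weights (`calib_step`). An explicit rational κ does so because e m² is small enough
(`arc_tan_bound`). -/

/-! ### The calibration inequality for one side -/

/-- A binary quadratic form with negative discriminant is positive. -/
lemma quadratic_form_pos {A B C x y : ℝ} (hA : 0 < A) (h : C ^ 2 < A * B) (h0 : x ≠ 0 ∨ y ≠ 0) :
    0 < A * x ^ 2 + B * y ^ 2 - 2 * C * (x * y) := by
  refine pos_of_mul_pos_right (a := A) ?_ hA.le
  have e : A * (A * x ^ 2 + B * y ^ 2 - 2 * C * (x * y))
      = (A * x - C * y) ^ 2 + (A * B - C ^ 2) * y ^ 2 := by ring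
  rw [e]
  by_cases hy : y = 0
  · have hx : x ≠ 0 := by tauto
    subst hy
    have : 0 < (A * x) ^ 2 := by positivity
    simpa using this
  · have : 0 < (A * B - C ^ 2) * y ^ 2 := mul_pos (by linarith) (by positivity)
    positivity

lemma calibration_slack {e k δ : ℝ} (he : 0 < e) (he' : e ≤ 1 / 10) (hk : k ≤ 1)
    (h : 8 * k ^ 2 * (1 - e) ^ 2 < (1 - e - k * e) * (δ * (1 - e) - e)) :
    0 < 1 - e - k * e ∧ 0 < δ * (1 - e) - e := by
  have hA : 0 < 1 - e - k * e := by nlinarith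
  refine ⟨hA, pos_of_mul_pos_right (a := 1 - e - k * e) ?_ hA.le⟩
  have : 0 ≤ 8 * k ^ 2 * (1 - e) ^ 2 := by positivity
  linarith

/-- The discriminant condition for the quadratic form in `deficit_pos`. The worst case is s = -2,
where it reduces to the hypothesis `h`; for the other s, (2 - s) z is at most its value 4 (1 - e) at
s = -2, and z is at least 1 - e. -/
lemma calibration_discrim {e k δ s z : ℝ} (he : 0 < e) (he' : e ≤ 1 / 10)
    (hk : k ≤ 1) (h : 8 * k ^ 2 * (1 - e) ^ 2 < (1 - e - k * e) * (δ * (1 - e) - e))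
    (hs : -2 ≤ s) (hs2 : s < 2) (hz : z = 1 + e * s / 2) :
    (k * ((2 - s) * z)) ^ 2 < (1 - e - k * e) * ((2 - s) / 2 * (δ * z - e)) := by
  obtain ⟨hA, -⟩ := calibration_slack he he' hk h
  generalize 1 - e - k * e = A at h hA ⊢
  have hz1 : 1 - e ≤ z := by nlinarith
  have hW4 : (2 - s) * z ≤ 4 * (1 - e) := by
    have h1 : (2 - s) * z = 4 * (1 - e) - (s + 2) * (1 - 2 * e + e * s / 2) := by rw [hz]; ring
    have h2 : 0 ≤ (s + 2) * (1 - 2 * e + e * s / 2) :=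
      mul_nonneg (by linarith) (by nlinarith)
    linarith
  have hdisc : 8 * k ^ 2 * (1 - e) * z < A * (δ * z - e) := by
    have e0 : 0 ≤ A * e := by positivity
    have e1 : 8 * k ^ 2 * (1 - e) ≤ A * δ := by
      have h1 : 8 * k ^ 2 * (1 - e) * (1 - e) < A * δ * (1 - e) := by linarith
      exact (lt_of_mul_lt_mul_right h1 (by linarith)).le
    have := mul_nonneg (sub_nonneg.2 e1) (sub_nonneg.2 hz1)
    linarith
  have hW0 : 0 ≤ (2 - s) * z := mul_nonneg (by linarith) (by linarith)
  calc (k * ((2 - s) * z)) ^ 2 = k ^ 2 * ((2 - s) * z * ((2 - s) * z)) := by ring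
    _ ≤ k ^ 2 * ((2 - s) * z * (4 * (1 - e))) := by gcongr
    _ = (2 - s) / 2 * (8 * k ^ 2 * (1 - e) * z) := by ring
    _ < (2 - s) / 2 * (A * (δ * z - e)) := mul_lt_mul_of_pos_left hdisc (by linarith)
    _ = _ := by ring

/-- The deficit of a side, after clearing denominators, in the variables `s = u + v`, `d = u - v`. -/
lemma deficit_pos {e κ δ s d : ℝ} (he : 0 < e) (he' : e ≤ 1 / 10) (hκ : |κ| ≤ 1)
    (hδ : 0 ≤ δ)
    (h : 8 * κ ^ 2 * (1 - e) ^ 2 < (1 - e - |κ| * e) * (δ * (1 - e) - e))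
    (hsd : |s| + |d| ≤ 2) (h0 : s ≠ 0 ∨ d ≠ 0) (hs2 : s < 2) :
    0 < d ^ 2 - e * s ^ 2 + e * s * (s ^ 2 - d ^ 2) / 2
      + (δ * (s ^ 2 + d ^ 2) / 2 - 2 * κ * d * s)
        * (2 - (1 - e) * s - e * (s ^ 2 - d ^ 2) / 2) := by
  have hs := abs_le.1 (show |s| ≤ 2 by linarith [abs_nonneg d])
  have hκ0 := abs_nonneg κ
  rw [← sq_abs κ] at h
  obtain ⟨hA, -⟩ := calibration_slack he he' hκ h
  obtain ⟨z, hz⟩ : ∃ z, z = 1 + e * s / 2 := ⟨_, rfl⟩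
  have hdisc := calibration_discrim he he' hκ h hs.1 hs2 hz
  have hquad := quadratic_form_pos (x := |d|) (y := |s|) hA hdisc
    (by simpa [or_comm] using h0)
  rw [sq_abs, sq_abs] at hquad
  have hz1 : 0 < z := by nlinarith
  -- The cleared denominator 2 - (1 - e) s - e (s² - d²) / 2 equals W + e d² / 2.
  obtain ⟨W, hW⟩ : ∃ W, W = (2 - s) * z := ⟨_, rfl⟩
  have hW0 : 0 < W := hW ▸ mul_pos (by linarith) hz1
  have hds : |s| * |d| ≤ 1 := by
    nlinarith [sq_nonneg (|s| - |d|), abs_nonneg s, abs_nonneg d]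
  have hcross : κ * d * s ≤ |κ| * (|s| * |d|) := by
    rw [show |κ| * (|s| * |d|) = |κ * d * s| by rw [abs_mul, abs_mul]; ring]
    exact le_abs_self _
  have hc1 : κ * d * s ≤ |κ| := hcross.trans (mul_le_of_le_one_right hκ0 hds)
  have t1 : 0 ≤ (|κ| * (|s| * |d|) - κ * d * s) * W := mul_nonneg (by linarith) hW0.le
  have t2 : 0 ≤ (|κ| - κ * d * s) * (e * d ^ 2) := mul_nonneg (by linarith) (by positivity)
  have t3 : 0 ≤ δ * d ^ 2 * (W + e * d ^ 2 / 2) := by positivity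
  have t4 : 0 ≤ δ * s ^ 2 * (e * d ^ 2) := by positivity
  have t5 : 0 ≤ d ^ 2 * (e * (2 - s)) :=
    mul_nonneg (by positivity) (mul_nonneg he.le (by linarith))
  -- The deficit is the positive definite form in |d|, |s| plus the nonnegative remainders `t1` to
  -- `t5`.
  have key : d ^ 2 - e * s ^ 2 + e * s * (s ^ 2 - d ^ 2) / 2
      + (δ * (s ^ 2 + d ^ 2) / 2 - 2 * κ * d * s)
        * (2 - (1 - e) * s - e * (s ^ 2 - d ^ 2) / 2)
      = ((1 - e - |κ| * e) * d ^ 2 + (2 - s) / 2 * (δ * z - e) * s ^ 2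
          - 2 * (|κ| * ((2 - s) * z)) * (|d| * |s|))
        + 2 * ((|κ| * (|s| * |d|) - κ * d * s) * W) + (|κ| - κ * d * s) * (e * d ^ 2)
        + δ * d ^ 2 * (W + e * d ^ 2 / 2) / 2 + δ * s ^ 2 * (e * d ^ 2) / 4
        + d ^ 2 * (e * (2 - s)) / 2 := by
    rw [hW, hz]; ring
  rw [key]
  linarith

/-- The normalized area of the triangle cut off over a side. -/
noncomputable def triangleArea (e w w' : ℝ) : ℝ :=
  (1 - w) * (1 + w') / (2 - (1 - e) * (w - w') + 2 * e * (w * w'))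

lemma triangle_denom_pos {e w w' : ℝ} (he : 0 < e) (he' : e ≤ 1 / 10) (hw : w ∈ Icc (-1 : ℝ) 1)
    (hw' : w' ∈ Icc (-1 : ℝ) 1) (h : w < 1 ∨ -1 < w') :
    0 < 2 - (1 - e) * (w - w') + 2 * e * (w * w') := by
  obtain ⟨a1, a2⟩ := hw
  obtain ⟨b1, b2⟩ := hw'
  rcases h with h | h
  · nlinarith [mul_nonneg (sub_nonneg.2 a2) (sub_nonneg.2 b2),
      mul_nonneg (sub_nonneg.2 a2) (by linarith : (0:ℝ) ≤ w' + 1),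
      mul_nonneg (by linarith : (0:ℝ) ≤ w + 1) (by linarith : (0:ℝ) ≤ w' + 1),
      mul_nonneg he.le (mul_nonneg (sub_nonneg.2 a2) (by linarith : (0:ℝ) ≤ w' + 1)),
      mul_nonneg he.le (mul_nonneg (by linarith : (0:ℝ) ≤ w + 1) (by linarith : (0:ℝ) ≤ w' + 1))]
  · nlinarith [mul_nonneg (sub_nonneg.2 a2) (sub_nonneg.2 b2),
      mul_nonneg (sub_nonneg.2 a2) (by linarith : (0:ℝ) ≤ w' + 1),
      mul_nonneg (by linarith : (0:ℝ) ≤ w + 1) (by linarith : (0:ℝ) ≤ w' + 1),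
      mul_nonneg he.le (mul_nonneg (sub_nonneg.2 a2) (by linarith : (0:ℝ) ≤ w' + 1)),
      mul_nonneg he.le (mul_nonneg (by linarith : (0:ℝ) ≤ w + 1) (by linarith : (0:ℝ) ≤ w' + 1))]

lemma triangleArea_lt {e κ κ' w w' : ℝ} (he : 0 < e) (he' : e ≤ 1 / 10)
    (hκ : |(κ + κ') / 2| ≤ 1) (hδ : κ ≤ κ')
    (h : 8 * ((κ + κ') / 2) ^ 2 * (1 - e) ^ 2
      < (1 - e - |(κ + κ') / 2| * e) * ((κ' - κ) * (1 - e) - e))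
    (hw : w ∈ Icc (-1 : ℝ) 1) (hw' : w' ∈ Icc (-1 : ℝ) 1) (h0 : w ≠ 0 ∨ w' ≠ 0) :
    triangleArea e w w'
      < 1 / 2 - (1 + e) / 2 * ((w / 2 + κ * w ^ 2) - (w' / 2 + κ' * w' ^ 2)) := by
  by_cases hc : w < 1 ∨ -1 < w'
  · have hD := triangle_denom_pos he he' hw hw' hc
    obtain ⟨a1, a2⟩ := hw
    obtain ⟨b1, b2⟩ := hw'
    rw [triangleArea, div_lt_iff₀ hD]
    have := deficit_pos (e := e) (κ := (κ + κ') / 2) (δ := κ' - κ) (s := w - w') (d := w + w')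
      he he' hκ (by linarith) h
      (by rcases abs_cases (w - w') with ⟨h1, _⟩ | ⟨h1, _⟩ <;>
          rcases abs_cases (w + w') with ⟨h2, _⟩ | ⟨h2, _⟩ <;> rw [h1, h2] <;> linarith)
      (by
        by_contra hcon
        push Not at hcon
        rcases h0 with h0 | h0 <;> apply h0 <;> linarith [hcon.1, hcon.2])
      (by rcases hc with hc | hc <;> linarith)
    have key : (1 / 2 - (1 + e) / 2 * ((w / 2 + κ * w ^ 2) - (w' / 2 + κ' * w' ^ 2)))
        * (2 - (1 - e) * (w - w') + 2 * e * (w * w')) - (1 - w) * (1 + w')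
        = (1 + e) / 4 * ((w + w') ^ 2 - e * (w - w') ^ 2
          + e * (w - w') * ((w - w') ^ 2 - (w + w') ^ 2) / 2
          + ((κ' - κ) * ((w - w') ^ 2 + (w + w') ^ 2) / 2
            - 2 * ((κ + κ') / 2) * (w + w') * (w - w'))
          * (2 - (1 - e) * (w - w') - e * ((w - w') ^ 2 - (w + w') ^ 2) / 2)) := by ring
    have : 0 < (1 + e) / 4 * ((w + w') ^ 2 - e * (w - w') ^ 2
          + e * (w - w') * ((w - w') ^ 2 - (w + w') ^ 2) / 2
          + ((κ' - κ) * ((w - w') ^ 2 + (w + w') ^ 2) / 2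
            - 2 * ((κ + κ') / 2) * (w + w') * (w - w'))
          * (2 - (1 - e) * (w - w') - e * ((w - w') ^ 2 - (w + w') ^ 2) / 2)) :=
      mul_pos (by linarith) this
    linarith
  -- At the corner w = 1, w' = -1 both supporting lines are the chord. The quotient is 0 / 0 = 0,
  -- which is the right area.
  · push Not at hc
    have hw1 : w = 1 := le_antisymm hw.2 hc.1
    have hw2 : w' = -1 := le_antisymm hc.2 hw'.1
    subst hw1 hw2
    simp only [triangleArea, sub_self, zero_mul, zero_div]
    rw [← sq_abs] at h
    have := (calibration_slack he he' hκ h).2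
    nlinarith

/-- On the two end sides one direction is pinned to 0 and the deficit factors exactly, so a
one-sided bound on a single weight is enough. -/
lemma triangleArea_zero_left_lt {e κ w : ℝ} (he : 0 < e) (he' : e ≤ 1 / 10)
    (hκ : -(1 / 8) ≤ κ) (hw : w ∈ Icc (-1 : ℝ) 1) (h0 : w ≠ 0) :
    triangleArea e 0 w < 1 / 2 + (1 + e) / 2 * (w / 2 + κ * w ^ 2) := by
  have hD := triangle_denom_pos he he' (w := 0) (by simp) hw (Or.inl one_pos)
  obtain ⟨b1, b2⟩ := hw
  rw [triangleArea, div_lt_iff₀ hD]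
  have hw2 : 0 < w ^ 2 := by positivity
  have key : (1 / 2 + (1 + e) / 2 * (w / 2 + κ * w ^ 2))
      * (2 - (1 - e) * (0 - w) + 2 * e * (0 * w)) - (1 - 0) * (1 + w)
      = (1 + e) / 4 * w ^ 2 * ((1 - e) + 2 * κ * (2 + (1 - e) * w)) := by ring
  have : 0 < (1 + e) / 4 * w ^ 2 * ((1 - e) + 2 * κ * (2 + (1 - e) * w)) := by
    apply mul_pos (by positivity)
    nlinarith [mul_nonneg (by linarith : (0 : ℝ) ≤ κ + 1 / 8)
      (by nlinarith : (0 : ℝ) ≤ 2 + (1 - e) * w)]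
  linarith

/-- Reflection (w, w') ↦ (-w', -w) preserves `triangleArea` and reduces this to the left end. -/
lemma triangleArea_zero_right_lt {e κ w : ℝ} (he : 0 < e) (he' : e ≤ 1 / 10)
    (hκ : κ ≤ 1 / 8) (hw : w ∈ Icc (-1 : ℝ) 1) (h0 : w ≠ 0) :
    triangleArea e w 0 < 1 / 2 - (1 + e) / 2 * (w / 2 + κ * w ^ 2) := by
  have := triangleArea_zero_left_lt (κ := -κ) (w := -w) he he' (by linarith)
    ⟨by linarith [hw.2], by linarith [hw.1]⟩ (neg_ne_zero.2 h0)
  have e1 : triangleArea e w 0 = triangleArea e 0 (-w) := by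
    simp only [triangleArea]; congr 1 <;> ring
  rw [e1]
  refine this.trans_eq ?_
  ring

/-! ### The calibration weights and the sum over all sides -/

/-- The weights of the calibration. -/
noncomputable def calib (m : ℝ) (i : ℝ) : ℝ := 3 / 16 * (i - m / 2) / ((m / 2) ^ 2 - (i - m / 2) ^ 2)

lemma abs_calib_le {m i : ℝ} (h1 : 1 ≤ i) (h2 : i ≤ m - 1) : |calib m i| ≤ 1 / 8 := by
  have hden : 0 < (m / 2) ^ 2 - (i - m / 2) ^ 2 := by nlinarith
  rw [calib, abs_le, le_div_iff₀ hden, div_le_iff₀ hden]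
  constructor <;> nlinarith

/-- The Riccati inequality for the mean κ and the increment δ of two consecutive weights, at the
midpoint x of their indices measured from the centre R = m / 2. Here Q is the product of the two
denominators. The constant 175/1000 is a quarter of the 7/10 bounding e m² / (1 - e), and 81/10
exceeds 8 to leave room for the factor 1 - e - |κ| e. -/
lemma calib_estimate {R x Q κ δ : ℝ} (hR : R = 3 / 2 ∨ 5 / 2 ≤ R)
    (hx1 : -(R - 3 / 2) ≤ x) (hx2 : x ≤ R - 3 / 2)
    (hQ : Q = ((R - 1 / 2) ^ 2 - x ^ 2) * ((R + 1 / 2) ^ 2 - x ^ 2))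
    (hδ : δ * Q = 3 / 16 * (R ^ 2 + x ^ 2 - 1 / 4))
    (hκ : κ * Q = 3 / 16 * (x * (R ^ 2 - x ^ 2 + 1 / 4))) :
    81 / 10 * κ ^ 2 < δ - 175 / 1000 / R ^ 2 := by
  have hR3 : 3 / 2 ≤ R := by rcases hR with h | h <;> linarith
  have hR0 : 0 < R ^ 2 := by positivity
  have hR94 : 9 / 4 ≤ R ^ 2 := by nlinarith
  have hxR : x ^ 2 ≤ (R - 3 / 2) ^ 2 := sq_le_sq' hx1 hx2
  have a1 : 2 * R - 2 ≤ (R - 1 / 2) ^ 2 - x ^ 2 := by linarith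
  have a2 : 4 * R - 2 ≤ (R + 1 / 2) ^ 2 - x ^ 2 := by linarith
  have a3 : (2 * R - 2) * (4 * R - 2) ≤ Q := by
    rw [hQ]
    exact mul_le_mul a1 a2 (by linarith) (by linarith)
  have hQ0 : 0 < Q := lt_of_lt_of_le (mul_pos (by linarith) (by linarith)) a3
  -- For R = 3/2 only x = 0 occurs. For R ≥ 5/2 the lower bound `a3` on Q suffices; at R = 2 the
  -- bound R² ≤ 27/100 Q can fail, which is why m = 4 is excluded.
  have hxA : x ^ 2 * R ^ 2 ≤ 27 / 100 * x ^ 2 * Q := by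
    rcases hR with hm | hm
    · have : x = 0 := by apply le_antisymm <;> linarith
      simp [this]
    · have a4 : R ^ 2 ≤ 27 / 100 * Q := by nlinarith
      calc x ^ 2 * R ^ 2 ≤ x ^ 2 * (27 / 100 * Q) := by gcongr
        _ = _ := by ring
  have hsq : (R ^ 2 - x ^ 2 + 1 / 4) ^ 2 = Q + R ^ 2 := by rw [hQ]; ring
  have e3 : Q / R ^ 2 ≤ R ^ 2 - x ^ 2 - 1 / 4 := by
    rw [div_le_iff₀ hR0]
    have h1 : 0 ≤ R ^ 2 - x ^ 2 - 1 / 4 := by linarith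
    have h2 : Q = (R ^ 2 - x ^ 2 - 1 / 4) * R ^ 2
        - ((R ^ 2 - x ^ 2 - 1 / 4) * (x ^ 2 + 1 / 4) + x ^ 2) := by rw [hQ]; ring
    have h3 : 0 ≤ (R ^ 2 - x ^ 2 - 1 / 4) * (x ^ 2 + 1 / 4) + x ^ 2 := by positivity
    linarith
  have e1 : κ ^ 2 * Q * Q = 9 / 256 * (x ^ 2 * (Q + R ^ 2)) := by
    rw [← hsq, show κ ^ 2 * Q * Q = (κ * Q) ^ 2 by ring, hκ]; ring
  have e4 : κ ^ 2 * Q * Q ≤ 9 / 256 * (127 / 100 * x ^ 2) * Q := by rw [e1]; linarith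
  have e5 : κ ^ 2 * Q ≤ 9 / 256 * (127 / 100 * x ^ 2) := le_of_mul_le_mul_right e4 hQ0
  have e6 : 175 / 1000 / R ^ 2 * Q = 175 / 1000 * (Q / R ^ 2) := by ring
  -- The coefficients of x² compare narrowly: 81/10 * 9/256 * 127/100 < 3/16 + 175/1000. Strictness
  -- comes from 3/16 > 175/1000 together with R² > 1/4.
  have : 81 / 10 * κ ^ 2 * Q < (δ - 175 / 1000 / R ^ 2) * Q := by
    rw [sub_mul, hδ, e6]
    linarith [sq_nonneg x]
  exact lt_of_mul_lt_mul_right this hQ0.le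

lemma calib_mid {m i R x : ℝ} (h1 : 1 ≤ i) (h2 : i + 1 ≤ m - 1) (hR : R = m / 2)
    (hx : x = i + 1 / 2 - R) :
    (calib m (i + 1) - calib m i) * (((R - 1 / 2) ^ 2 - x ^ 2) * ((R + 1 / 2) ^ 2 - x ^ 2))
      = 3 / 16 * (R ^ 2 + x ^ 2 - 1 / 4) ∧
    (calib m i + calib m (i + 1)) / 2 * (((R - 1 / 2) ^ 2 - x ^ 2) * ((R + 1 / 2) ^ 2 - x ^ 2))
      = 3 / 16 * (x * (R ^ 2 - x ^ 2 + 1 / 4)) := by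
  have hi : i = x - 1 / 2 + R := by linarith
  have hp1 : 0 < R ^ 2 - (x - 1 / 2) ^ 2 := by nlinarith
  have hp2 : 0 < R ^ 2 - (x + 1 / 2) ^ 2 := by nlinarith
  have c1 : calib m i * (R ^ 2 - (x - 1 / 2) ^ 2) = 3 / 16 * (x - 1 / 2) := by
    rw [calib, ← hR, hi, show x - 1 / 2 + R - R = x - 1 / 2 by ring, div_mul_cancel₀ _ hp1.ne']
  have c2 : calib m (i + 1) * (R ^ 2 - (x + 1 / 2) ^ 2) = 3 / 16 * (x + 1 / 2) := by
    rw [calib, ← hR, hi, show x - 1 / 2 + R + 1 - R = x + 1 / 2 by ring,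
      div_mul_cancel₀ _ hp2.ne']
  constructor
  · linear_combination (R ^ 2 - (x - 1 / 2) ^ 2) * c2 - (R ^ 2 - (x + 1 / 2) ^ 2) * c1
  · linear_combination (R ^ 2 - (x - 1 / 2) ^ 2) / 2 * c2 + (R ^ 2 - (x + 1 / 2) ^ 2) / 2 * c1

/-- Turns `calib_estimate` into the hypotheses of `triangleArea_lt` for an inner side: the bound on
e m² replaces 175/1000 / R² by e / (1 - e), and 99/100 * 81/10 ≥ 8 absorbs the factor 1 - e - |κ| e.
-/
lemma calib_step {m i e : ℝ} (h1 : 1 ≤ i) (h2 : i + 1 ≤ m - 1) (hm : m = 3 ∨ 5 ≤ m)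
    (he : 0 < e) (hem : e * m ^ 2 ≤ 7 / 10 * (1 - e)) :
    calib m i ≤ calib m (i + 1) ∧ |(calib m i + calib m (i + 1)) / 2| ≤ 1 / 8 ∧
    8 * ((calib m i + calib m (i + 1)) / 2) ^ 2 * (1 - e) ^ 2
      < (1 - e - |(calib m i + calib m (i + 1)) / 2| * e)
        * ((calib m (i + 1) - calib m i) * (1 - e) - e) := by
  have hk1 := abs_le.1 (abs_calib_le h1 (by linarith : i ≤ m - 1))
  have hk2 := abs_le.1 (abs_calib_le (by linarith : 1 ≤ i + 1) h2)
  have hk : |(calib m i + calib m (i + 1)) / 2| ≤ 1 / 8 := by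
    rw [abs_le]
    constructor <;> linarith [hk1.1, hk1.2, hk2.1, hk2.2]
  obtain ⟨R, hR⟩ : ∃ R, R = m / 2 := ⟨_, rfl⟩
  obtain ⟨x, hx⟩ : ∃ x, x = i + 1 / 2 - R := ⟨_, rfl⟩
  obtain ⟨d1, d2⟩ := calib_mid h1 h2 hR hx
  have main := calib_estimate (by rcases hm with h | h; left; linarith; right; linarith)
    (by linarith) (by linarith) rfl d1 d2
  generalize (calib m i + calib m (i + 1)) / 2 = κ at *
  have hδ : calib m i ≤ calib m (i + 1) := by
    have : 0 ≤ 81 / 10 * κ ^ 2 + 175 / 1000 / R ^ 2 := by positivity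
    linarith
  generalize calib m (i + 1) - calib m i = δ at *
  refine ⟨hδ, hk, ?_⟩
  have hm9 : 9 ≤ m ^ 2 := by nlinarith
  have hmp : 0 < m ^ 2 := by positivity
  have he1 : 0 < 1 - e := by nlinarith
  have hge : e ≤ 175 / 1000 / R ^ 2 * (1 - e) := by
    have hR0 : 0 < R := by linarith
    rw [div_mul_eq_mul_div, le_div_iff₀ (by positivity), hR]; linarith
  have hA : 99 / 100 * (1 - e) ≤ 1 - e - |κ| * e := by
    have : e * 9 ≤ 7 / 10 * (1 - e) := (mul_le_mul_of_nonneg_left hm9 he.le).trans hem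
    have : |κ| * e ≤ 1 / 8 * e := mul_le_mul_of_nonneg_right hk he.le
    linarith
  have hB : 81 / 10 * κ ^ 2 * (1 - e) < δ * (1 - e) - e := by
    have := mul_lt_mul_of_pos_right main he1
    linarith
  have hκ0 : 0 ≤ κ ^ 2 * (1 - e) ^ 2 := by positivity
  have hp : 0 < δ * (1 - e) - e := by
    have : 0 ≤ 81 / 10 * κ ^ 2 * (1 - e) := by positivity
    linarith
  calc 8 * κ ^ 2 * (1 - e) ^ 2 ≤ 99 / 100 * (1 - e) * (81 / 10 * κ ^ 2 * (1 - e)) := by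
        linarith
    _ < 99 / 100 * (1 - e) * (δ * (1 - e) - e) :=
        mul_lt_mul_of_pos_left hB (by linarith)
    _ ≤ _ := mul_le_mul_of_nonneg_right hA hp.le

/-- The total normalized area of the triangles is largest for the tangent polygon. -/
lemma sum_triangleArea {m : ℕ} {e : ℝ} (hm : m = 3 ∨ 5 ≤ m) (he : 0 < e) (he' : e ≤ 1 / 10)
    (hem : e * m ^ 2 ≤ 7 / 10 * (1 - e)) (w : ℕ → ℝ) (hw : ∀ i ≤ m, w i ∈ Icc (-1 : ℝ) 1)
    (w0 : w 0 = 0) (wm : w m = 0) :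
    ∑ i ∈ Finset.range m, triangleArea e (w i) (w (i + 1)) ≤ m / 2 ∧
    (∑ i ∈ Finset.range m, triangleArea e (w i) (w (i + 1)) = m / 2 → ∀ i ≤ m, w i = 0) := by
  -- The values of `calib` at 0 and m are divisions by zero, but they are multiplied by w 0 = w m =
  -- 0.
  set Φ : ℕ → ℝ := fun i => w i / 2 + calib m i * w i ^ 2 with hΦ
  have hm3 : 3 ≤ m := by omega
  have hmR : (3 : ℝ) ≤ m := by exact_mod_cast hm3
  have zero_zero : triangleArea e 0 0 = 1 / 2 := by simp [triangleArea]
  have step : ∀ i < m, triangleArea e (w i) (w (i + 1)) ≤ 1 / 2 - (1 + e) / 2 * (Φ i - Φ (i + 1))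
      ∧ (w i ≠ 0 ∨ w (i + 1) ≠ 0 →
        triangleArea e (w i) (w (i + 1)) < 1 / 2 - (1 + e) / 2 * (Φ i - Φ (i + 1))) := by
    intro i hi
    have lt : w i ≠ 0 ∨ w (i + 1) ≠ 0 →
        triangleArea e (w i) (w (i + 1)) < 1 / 2 - (1 + e) / 2 * (Φ i - Φ (i + 1)) := by
      intro h0
      rcases Nat.eq_zero_or_pos i with rfl | hi0
      · have hb := abs_le.1 (abs_calib_le (m := m) (i := ((0 + 1 : ℕ) : ℝ)) (by simp)
          (by push_cast; linarith))
        have := triangleArea_zero_left_lt he he' hb.1 (hw (0 + 1) (by omega))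
          (by tauto)
        simp only [hΦ, w0]
        refine this.trans_eq ?_
        ring
      · have hi1 : (1 : ℝ) ≤ i := by exact_mod_cast hi0
        rcases eq_or_ne (i + 1) m with him | him
        · have hiR : (i : ℝ) = m - 1 := by rw [← him]; push_cast; ring
          have hb := abs_le.1 (abs_calib_le hi1 hiR.le)
          have := triangleArea_zero_right_lt (κ := calib m i) he he' (by linarith [hb.2])
            (hw i hi.le) (by rw [him] at h0; tauto)
          simp only [hΦ, him, wm]
          refine this.trans_eq ?_
          ring
        · have hi2 : (i : ℝ) + 1 ≤ m - 1 := by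
            have : i + 2 ≤ m := by omega
            have : ((i + 2 : ℕ) : ℝ) ≤ m := by exact_mod_cast this
            push_cast at this; linarith
          obtain ⟨s1, s2, s3⟩ := calib_step hi1 hi2 (by exact_mod_cast hm) he hem
          have := triangleArea_lt he he' (by linarith) s1 s3 (hw i hi.le) (hw (i + 1) hi) h0
          simp only [hΦ]
          push_cast
          exact this
    refine ⟨?_, lt⟩
    by_cases h0 : w i ≠ 0 ∨ w (i + 1) ≠ 0
    · exact (lt h0).le
    · push Not at h0
      simp [hΦ, h0.1, h0.2, zero_zero]
  have tele : ∑ i ∈ Finset.range m, (1 / 2 - (1 + e) / 2 * (Φ i - Φ (i + 1))) = m / 2 := by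
    rw [Finset.sum_sub_distrib, ← Finset.mul_sum, Finset.sum_range_sub']
    simp [hΦ, w0, wm, div_eq_mul_inv]
  refine ⟨tele ▸ Finset.sum_le_sum fun i hi => (step i (Finset.mem_range.1 hi)).1, ?_⟩
  intro heq i hi
  rcases hi.eq_or_lt with rfl | hi
  · exact wm
  by_contra hne
  have := Finset.sum_lt_sum (fun i hi => (step i (Finset.mem_range.1 hi)).1)
    ⟨i, Finset.mem_range.2 hi, (step i hi).2 (Or.inl hne)⟩
  rw [tele, heq] at this
  exact lt_irrefl _ this

/-! ### Area under a curve from supporting lines -/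

lemma integral_ge_of_line {f : ℝ → ℝ} {a p y X Y : ℝ} (hX : 0 < X)
    (hf : IntervalIntegrable f MeasureTheory.volume a (a + X))
    (h : ∀ x ∈ Icc a (a + X), X * y + Y * (x - p) ≤ X * f x) :
    X * y + Y * (a + X / 2 - p) ≤ ∫ x in a..a + X, f x := by
  have e : ∫ x in a..a + X, ((y - Y / X * p) + Y / X * x) = X * y + Y * (a + X / 2 - p) := by
    rw [intervalIntegral.integral_add (by simp) (by apply Continuous.intervalIntegrable; fun_prop),
      intervalIntegral.integral_const_mul, integral_id, intervalIntegral.integral_const]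
    simp only [smul_eq_mul]
    field_simp
    ring
  rw [← e]
  refine intervalIntegral.integral_mono_on (by linarith)
    (by apply Continuous.intervalIntegrable; fun_prop) hf fun x hx => ?_
  have := h x hx
  refine le_of_mul_le_mul_left ?_ hX
  refine le_trans (le_of_eq ?_) this
  field_simp
  ring

/-- A function lying above two lines through `(a, ya)` and `(b, yb)` on either side of the
apex `(a + X₁, ya + Y₁)` of a triangle has at least the corresponding integral. -/
lemma integral_ge_of_triangle {f : ℝ → ℝ} {a b ya yb X₁ Y₁ X₂ Y₂ : ℝ} (h₁ : 0 ≤ X₁) (h₂ : 0 ≤ X₂)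
    (hb : b = a + X₁ + X₂) (hy : yb = ya + Y₁ + Y₂)
    (hf : IntervalIntegrable f MeasureTheory.volume a b)
    (hl : ∀ x ∈ Icc a (a + X₁), X₁ * ya + Y₁ * (x - a) ≤ X₁ * f x)
    (hr : ∀ x ∈ Icc (a + X₁) b, X₂ * yb + Y₂ * (x - b) ≤ X₂ * f x) :
    (b - a) * (ya + yb) / 2 - (X₁ * Y₂ - X₂ * Y₁) / 2 ≤ ∫ x in a..b, f x := by
  have hf1 : IntervalIntegrable f MeasureTheory.volume a (a + X₁) :=
    hf.mono_set (by
      rw [uIcc_of_le (by linarith), uIcc_of_le (by linarith)]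
      exact Icc_subset_Icc_right (by linarith))
  have hf2 : IntervalIntegrable f MeasureTheory.volume (a + X₁) b :=
    hf.mono_set (by
      rw [uIcc_of_le (by linarith), uIcc_of_le (by linarith)]
      exact Icc_subset_Icc_left (by linarith))
  rw [← intervalIntegral.integral_add_adjacent_intervals hf1 hf2]
  have i1 : X₁ * ya + Y₁ * (X₁ / 2) ≤ ∫ x in a..a + X₁, f x := by
    -- An edge with X₁ = 0 is vertical or trivial and contributes nothing. Keeping direction vectors
    -- instead of slopes admits the line x = 1.
    rcases h₁.eq_or_lt with h | h
    · simp [← h]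
    · have := integral_ge_of_line h hf1 hl
      linarith
  have i2 : X₂ * yb - Y₂ * (X₂ / 2) ≤ ∫ x in a + X₁..b, f x := by
    rcases h₂.eq_or_lt with h | h
    · have : a + X₁ = b := by linarith
      simp [← h, this]
    · rw [hb] at hf2 hr ⊢
      have := integral_ge_of_line h hf2 hr
      linarith
  refine le_trans (le_of_eq ?_) (add_le_add i1 i2)
  rw [hb, hy]; ring

/-- The lower bound for the integral of a curve over a side of a polygon inscribed in the unit
circle with center `(0, 1)`, in terms of the directions of supporting lines at its ends.  The side
has direction `γ` and length `2 * sin η`. -/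
lemma integral_ge_side {f : ℝ → ℝ} {γ η w w' e : ℝ} (hs : 0 < Real.sin η) (hc : 0 < Real.cos η)
    (hee : e = (Real.sin η / Real.cos η) ^ 2)
    (he' : e ≤ 1 / 10) (hw : w ∈ Icc (-1 : ℝ) 1) (hw' : w' ∈ Icc (-1 : ℝ) 1)
    (hf : IntervalIntegrable f MeasureTheory.volume (Real.sin (γ - η)) (Real.sin (γ + η)))
    (hd : 0 ≤ Real.cos η * Real.cos (γ - η) - w * Real.sin η * Real.sin (γ - η))
    (hd' : 0 ≤ Real.cos η * Real.cos (γ + η) - w' * Real.sin η * Real.sin (γ + η))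
    (hl : ∀ x ∈ Icc (Real.sin (γ - η)) (Real.sin (γ + η)),
      (Real.cos η * Real.sin (γ - η) + w * Real.sin η * Real.cos (γ - η)) * (x - Real.sin (γ - η))
      ≤ (Real.cos η * Real.cos (γ - η) - w * Real.sin η * Real.sin (γ - η))
        * (f x - (1 - Real.cos (γ - η))))
    (hr : ∀ x ∈ Icc (Real.sin (γ - η)) (Real.sin (γ + η)),
      (Real.cos η * Real.sin (γ + η) + w' * Real.sin η * Real.cos (γ + η)) * (x - Real.sin (γ + η))
      ≤ (Real.cos η * Real.cos (γ + η) - w' * Real.sin η * Real.sin (γ + η))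
        * (f x - (1 - Real.cos (γ + η)))) :
    (Real.sin (γ + η) - Real.sin (γ - η)) * ((1 - Real.cos (γ - η)) + (1 - Real.cos (γ + η))) / 2
      - 2 * Real.sin η ^ 3 / Real.cos η * triangleArea e w w'
      ≤ ∫ x in Real.sin (γ - η)..Real.sin (γ + η), f x := by
  have hsc : Real.sin η ^ 2 + Real.cos η ^ 2 = 1 := Real.sin_sq_add_cos_sq η
  have f1 := Real.sin_sub γ η
  have f2 := Real.sin_add γ η
  have f3 := Real.cos_sub γ η
  have f4 := Real.cos_add γ η
  generalize Real.sin (γ - η) = a at *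
  generalize Real.sin (γ + η) = b at *
  generalize Real.cos (γ - η) = Ca at *
  generalize Real.cos (γ + η) = Cb at *
  generalize Real.sin η = s at *
  generalize Real.cos η = c at *
  have hCS : Real.cos γ ^ 2 + Real.sin γ ^ 2 = 1 := Real.cos_sq_add_sin_sq γ
  generalize Real.cos γ = C at *
  generalize Real.sin γ = S at *
  have he : 0 < e := by rw [hee]; positivity
  -- it suffices to decompose the side along the two directions
  suffices H : ∃ r r' : ℝ, 0 ≤ r ∧ 0 ≤ r' ∧ r * (c ^ 2 + w * s ^ 2) + r' * (c ^ 2 - w' * s ^ 2) = 2 * s ∧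
      r * (1 - w) = r' * (1 + w') ∧
      r * r' * (c * s * (2 * c ^ 2 - (c ^ 2 - s ^ 2) * (w - w') + 2 * s ^ 2 * (w * w')))
        = 4 * s ^ 3 / c * triangleArea e w w' by
    obtain ⟨r, r', hr0, hr0', h1, h2, h3⟩ := H
    have hb : b = a + r * (c * Ca - w * s * a) + r' * (c * Cb - w' * s * b) := by
      rw [f1, f2, f3, f4]
      linear_combination (-C) * h1 - S * c * s * h2
    have hy : 1 - Cb = 1 - Ca + r * (c * a + w * s * Ca) + r' * (c * b + w' * s * Cb) := by
      rw [f1, f2, f3, f4]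
      linear_combination (-S) * h1 + C * c * s * h2
    have := integral_ge_of_triangle (mul_nonneg hr0 hd) (mul_nonneg hr0' hd') hb hy hf
      (fun x hx => by
        have := mul_le_mul_of_nonneg_left (hl x ⟨hx.1, hx.2.trans (by
          linarith [mul_nonneg hr0' hd'])⟩) hr0
        linarith)
      (fun x hx => by
        have := mul_le_mul_of_nonneg_left (hr x ⟨le_trans (by
          linarith [mul_nonneg hr0 hd]) hx.1, hx.2⟩) hr0'
        linarith)
    refine le_trans (le_of_eq ?_) this
    have cross : (c * Ca - w * s * a) * (c * b + w' * s * Cb)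
        - (c * Cb - w' * s * b) * (c * a + w * s * Ca)
        = c * s * (2 * c ^ 2 - (c ^ 2 - s ^ 2) * (w - w') + 2 * s ^ 2 * (w * w')) := by
      rw [f1, f2, f3, f4]
      linear_combination (c * s * (2 * c ^ 2 - (c ^ 2 - s ^ 2) * (w - w') + 2 * s ^ 2 * (w * w'))) * hCS
    rw [← cross] at h3
    linear_combination (1 / 2) * h3
  by_cases hcase : w < 1 ∨ -1 < w'
  · have hD := triangle_denom_pos he he' hw hw' hcase
    set Den := 2 - (1 - e) * (w - w') + 2 * e * (w * w') with hDen
    have hq : 2 * c ^ 2 - (c ^ 2 - s ^ 2) * (w - w') + 2 * s ^ 2 * (w * w') = c ^ 2 * Den := by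
      rw [hDen, hee]; field_simp
    -- Cramer's rule: the two linear equations are the components of the chord along and across its
    -- own direction γ.
    refine ⟨2 * s * (1 + w') / (c ^ 2 * Den), 2 * s * (1 - w) / (c ^ 2 * Den), ?_, ?_, ?_, ?_, ?_⟩
    · have := hw'.1; apply div_nonneg _ (by positivity); apply mul_nonneg <;> linarith
    · have := hw.2; apply div_nonneg _ (by positivity); apply mul_nonneg <;> linarith
    · rw [div_mul_eq_mul_div, div_mul_eq_mul_div, ← add_div, div_eq_iff (by positivity), ← hq]
      ring
    · ring
    · rw [hq, triangleArea, ← hDen]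
      field_simp
      ring
  -- Both directions are that of the chord, so the decomposition is not unique; the first vector
  -- alone is taken.
  · push Not at hcase
    have hw1 : w = 1 := le_antisymm hw.2 hcase.1
    have hw2 : w' = -1 := le_antisymm hcase.2 hw'.1
    subst hw1 hw2
    refine ⟨2 * s, 0, by positivity, le_rfl, ?_, by ring, by simp [triangleArea]⟩
    linear_combination 2 * s * hsc

/-! ### Integrability and supporting lines of Lorenz curves -/

lemma IsLorenzCurve.monotoneOn {L : ℝ → ℝ} (hL : IsLorenzCurve L) : MonotoneOn L (Icc 0 1) := by
  intro x hx y hy hxy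
  rcases hx.1.eq_or_lt with h0 | h0
  · rw [← h0, hL.map_zero]; exact hL.nonneg y hy
  have hy0 : 0 < y := h0.trans_le hxy
  have := hL.convexOn.2 (left_mem_Icc.2 zero_le_one) hy
    (sub_nonneg.2 (div_le_one_of_le₀ hxy hy0.le)) (by positivity : 0 ≤ x / y) (by ring)
  simp only [smul_eq_mul, mul_zero, zero_add, hL.map_zero, div_mul_cancel₀ _ hy0.ne'] at this
  exact this.trans (mul_le_of_le_one_left (hL.nonneg y hy) (div_le_one_of_le₀ hxy hy0.le))

lemma IsLorenzCurve.intervalIntegrable {L : ℝ → ℝ} (hL : IsLorenzCurve L) {a b : ℝ}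
    (ha : a ∈ Icc (0 : ℝ) 1) (hb : b ∈ Icc (0 : ℝ) 1) :
    IntervalIntegrable L MeasureTheory.volume a b :=
  (hL.monotoneOn.mono (uIcc_subset_Icc ha hb)).intervalIntegrable

lemma gini_eq {L : ℝ → ℝ} (hL : IsLorenzCurve L) : gini L = 1 - 2 * ∫ x in (0 : ℝ)..1, L x := by
  rw [gini, intervalIntegral.integral_sub (by simp)
    (hL.intervalIntegrable (by simp) (by simp)), integral_id]
  ring

lemma ConvexOn.exists_supporting_line {S : Set ℝ} {f : ℝ → ℝ} (hf : ConvexOn ℝ S f) {p : ℝ}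
    (hp : p ∈ interior S) : ∃ σ : ℝ, ∀ x ∈ S, f p + σ * (x - p) ≤ f x := by
  refine ⟨derivWithin f (Ioi p) p, fun x hx => ?_⟩
  rcases lt_trichotomy p x with h | rfl | h
  · have := hf.rightDeriv_le_slope_of_mem_interior hp hx h
    rw [slope_def_field, le_div_iff₀ (by linarith)] at this
    linarith
  · simp
  · have := (hf.slope_le_leftDeriv_of_mem_interior hx hp h).trans
      (hf.leftDeriv_le_rightDeriv_of_mem_interior hp)
    rw [slope_def_field, div_le_iff₀ (by linarith)] at this
    linarith

/-! ### Points on the circular arc and the lower bound for the integral -/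

section Arc

variable {m : ℕ} {η : ℝ}

lemma arc_pos (hm : 3 ≤ m) (hη : 2 * m * η = Real.pi / 2) : 0 < η := by
  have : (0 : ℝ) < 2 * m := by positivity
  exact pos_of_mul_pos_right (by rw [hη]; positivity) this.le

lemma arc_mem {t : ℝ} (hm : 3 ≤ m) (hη : 2 * m * η = Real.pi / 2) (h0 : 0 ≤ t) (h1 : t ≤ m) :
    2 * t * η ∈ Icc 0 (Real.pi / 2) := by
  have := arc_pos hm hη
  refine ⟨by positivity, ?_⟩
  rw [← hη]; gcongr

lemma arc_sin_nonneg {t : ℝ} (hm : 3 ≤ m) (hη : 2 * m * η = Real.pi / 2) (h0 : 0 ≤ t)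
    (h1 : t ≤ m) : 0 ≤ Real.sin (2 * t * η) :=
  Real.sin_nonneg_of_mem_Icc ⟨(arc_mem hm hη h0 h1).1,
    (arc_mem hm hη h0 h1).2.trans (by linarith [Real.pi_pos])⟩

lemma arc_cos_nonneg {t : ℝ} (hm : 3 ≤ m) (hη : 2 * m * η = Real.pi / 2) (h0 : 0 ≤ t)
    (h1 : t ≤ m) : 0 ≤ Real.cos (2 * t * η) :=
  Real.cos_nonneg_of_mem_Icc ⟨by linarith [(arc_mem hm hη h0 h1).1, Real.pi_pos],
    (arc_mem hm hη h0 h1).2⟩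

lemma arc_cos_pos {t : ℝ} (hm : 3 ≤ m) (hη : 2 * m * η = Real.pi / 2) (h0 : 0 ≤ t)
    (h1 : t < m) : 0 < Real.cos (2 * t * η) := by
  refine Real.cos_pos_of_mem_Ioo ⟨by linarith [(arc_mem hm hη h0 h1.le).1, Real.pi_pos], ?_⟩
  have := arc_pos hm hη
  rw [← hη]; gcongr

lemma arc_sin_pos {t : ℝ} (hm : 3 ≤ m) (hη : 2 * m * η = Real.pi / 2) (h0 : 0 < t)
    (h1 : t ≤ m) : 0 < Real.sin (2 * t * η) := by
  have := arc_pos hm hη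
  exact Real.sin_pos_of_pos_of_lt_pi (by positivity)
    ((arc_mem hm hη h0.le h1).2.trans_lt (by linarith [Real.pi_pos]))

lemma arc_sin_mem {t : ℝ} (hm : 3 ≤ m) (hη : 2 * m * η = Real.pi / 2) (h0 : 0 ≤ t)
    (h1 : t ≤ m) : Real.sin (2 * t * η) ∈ Icc (0 : ℝ) 1 :=
  ⟨arc_sin_nonneg hm hη h0 h1, Real.sin_le_one _⟩

lemma arc_half_pos (hm : 3 ≤ m) (hη : 2 * m * η = Real.pi / 2) :
    0 < Real.sin η ∧ 0 < Real.cos η := by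
  have hm' : (3 : ℝ) ≤ m := by exact_mod_cast hm
  have h1 := arc_sin_pos (t := 1 / 2) hm hη (by norm_num) (by linarith)
  have h2 := arc_cos_pos (t := 1 / 2) hm hη (by norm_num) (by linarith)
  have e : 2 * (1 / 2) * η = η := by ring
  rw [e] at h1 h2
  exact ⟨h1, h2⟩

lemma arc_tan_bound (hm : m = 3 ∨ 5 ≤ m) (hη : 2 * m * η = Real.pi / 2) :
    (Real.sin η / Real.cos η) ^ 2 ≤ 1 / 10 ∧
    (Real.sin η / Real.cos η) ^ 2 * m ^ 2 ≤ 7 / 10 * (1 - (Real.sin η / Real.cos η) ^ 2) := by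
  have hm3 : 3 ≤ m := by omega
  obtain ⟨hs, hc⟩ := arc_half_pos hm3 hη
  have hη0 := arc_pos hm3 hη
  have hsc := Real.sin_sq_add_cos_sq η
  -- This is the second claim with denominators cleared, using cos² = 1 - sin². The case m = 3 is
  -- nearly sharp and needs the exact value of cos (π / 6); for m ≥ 5 the bound sin η < η suffices.
  have key : Real.sin η ^ 2 * (m ^ 2 + 7 / 5) ≤ 7 / 10 := by
    rcases hm with rfl | hm
    · have h6 : 2 * η = Real.pi / 6 := by push_cast at hη; linarith
      have h1 := Real.cos_two_mul η
      rw [h6, Real.cos_pi_div_six] at h1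
      push_cast
      have : Real.sin η ^ 2 = 1 / 2 - √3 / 4 := by linarith
      have h3 : (1.732 : ℝ) ≤ √3 := Real.le_sqrt_of_sq_le (by norm_num)
      linarith
    · have hm5 : (5 : ℝ) ≤ m := by exact_mod_cast hm
      have h1 : Real.sin η ^ 2 ≤ η ^ 2 := by
        have := Real.sin_lt hη0
        gcongr
      have h2 : (m : ℝ) * η ≤ 0.786 := by linarith [Real.pi_lt_d4]
      have h2' : ((m : ℝ) * η) ^ 2 ≤ 0.786 ^ 2 := by gcongr
      have h3 : 5 * η ≤ m * η := by gcongr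
      have h4 : η ≤ 0.158 := by linarith
      have h4' : η ^ 2 ≤ 0.158 ^ 2 := by gcongr
      calc Real.sin η ^ 2 * (m ^ 2 + 7 / 5) ≤ η ^ 2 * (m ^ 2 + 7 / 5) := by gcongr
        _ = (m * η) ^ 2 + 7 / 5 * η ^ 2 := by ring
        _ ≤ 7 / 10 := by norm_num at h2' h4'; linarith
  have hm9 : (9 : ℝ) ≤ m ^ 2 := by
    have : (3 : ℝ) ≤ m := by exact_mod_cast hm3
    nlinarith
  have hs2 : Real.sin η ^ 2 * 9 ≤ Real.sin η ^ 2 * m ^ 2 := by gcongr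
  rw [div_pow]
  constructor
  · rw [div_le_iff₀ (by positivity)]; linarith
  · rw [div_mul_eq_mul_div, one_sub_div (by positivity), ← mul_div_assoc]
    exact div_le_div_of_nonneg_right (by linarith) (by positivity)

/-- A convex curve through the points has supporting lines there; `w` is the normalized tangent of
the angle between the supporting line and the tangent of the circle. -/
lemma exists_supporting_directions (hm : 3 ≤ m) (hη : 2 * m * η = Real.pi / 2) {M : ℝ → ℝ}
    (hM : IsLorenzCurve M)
    (hp : ∀ k : ℕ, k ≤ m → M (Real.sin (2 * k * η)) = 1 - Real.cos (2 * k * η)) :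
    ∃ w : ℕ → ℝ, w 0 = 0 ∧ w m = 0 ∧ ∀ i ≤ m, w i ∈ Icc (-1 : ℝ) 1 ∧
      0 ≤ Real.cos η * Real.cos (2 * i * η) - w i * Real.sin η * Real.sin (2 * i * η) ∧
      ∀ x ∈ Icc (0 : ℝ) 1,
        (Real.cos η * Real.sin (2 * i * η) + w i * Real.sin η * Real.cos (2 * i * η))
            * (x - Real.sin (2 * i * η))
          ≤ (Real.cos η * Real.cos (2 * i * η) - w i * Real.sin η * Real.sin (2 * i * η))
            * (M x - (1 - Real.cos (2 * i * η))) := by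
  obtain ⟨hs, hc⟩ := arc_half_pos hm hη
  suffices H : ∀ i : ℕ, ∃ w : ℝ, i ≤ m → ((i = 0 → w = 0) ∧ (i = m → w = 0) ∧ w ∈ Icc (-1 : ℝ) 1 ∧
      0 ≤ Real.cos η * Real.cos (2 * i * η) - w * Real.sin η * Real.sin (2 * i * η) ∧
      ∀ x ∈ Icc (0 : ℝ) 1,
        (Real.cos η * Real.sin (2 * i * η) + w * Real.sin η * Real.cos (2 * i * η))
            * (x - Real.sin (2 * i * η))
          ≤ (Real.cos η * Real.cos (2 * i * η) - w * Real.sin η * Real.sin (2 * i * η))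
            * (M x - (1 - Real.cos (2 * i * η)))) by
    choose w hw using H
    exact ⟨w, (hw 0 (Nat.zero_le m)).1 rfl, (hw m le_rfl).2.1 rfl, fun i hi => (hw i hi).2.2⟩
  intro i
  by_cases him : i ≤ m
  swap
  · exact ⟨0, fun h => absurd h him⟩
  -- At the ends the supporting lines are y = 0 and x = 1, both tangent to the circle, so w = 0; a
  -- jump of M at 1 does no harm.
  rcases Nat.eq_zero_or_pos i with rfl | hi0
  · refine ⟨0, fun _ => ⟨fun _ => rfl, fun _ => rfl, by simp, by simp [hc.le], fun x hx => ?_⟩⟩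
    simp only [Nat.cast_zero, mul_zero, zero_mul, Real.sin_zero, Real.cos_zero, mul_one, add_zero,
      sub_self, sub_zero]
    exact mul_nonneg hc.le (hM.nonneg x hx)
  rcases him.eq_or_lt with rfl | him
  · refine ⟨0, fun _ => ⟨fun _ => rfl, fun _ => rfl, by simp, ?_, fun x hx => ?_⟩⟩
    · rw [hη]; simp
    · rw [hη]
      simp only [Real.sin_pi_div_two, Real.cos_pi_div_two, mul_one, mul_zero, zero_mul, add_zero,
        sub_self]
      exact mul_nonpos_of_nonneg_of_nonpos hc.le (by linarith [hx.2])
  have hi0' : (0 : ℝ) < i := by exact_mod_cast hi0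
  have him' : (i : ℝ) < m := by exact_mod_cast him
  have hi1' : (1 : ℝ) ≤ i := by exact_mod_cast hi0
  have him1' : (i : ℝ) + 1 ≤ m := by exact_mod_cast him
  have hS := arc_sin_pos hm hη hi0' him'.le
  have hC := arc_cos_pos hm hη hi0'.le him'
  have hCS := Real.sin_sq_add_cos_sq (2 * i * η)
  have hmem : Real.sin (2 * i * η) ∈ interior (Icc (0 : ℝ) 1) := by
    rw [interior_Icc]; exact ⟨hS, by nlinarith [Real.sin_le_one (2 * i * η)]⟩
  obtain ⟨σ, hσ⟩ := hM.convexOn.exists_supporting_line hmem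
  rw [hp i him.le] at hσ
  have hσ0 : 0 ≤ σ := by
    have := hσ 0 (by simp)
    rw [hM.map_zero] at this
    have h1 := Real.cos_le_one (2 * i * η)
    exact nonneg_of_mul_nonneg_left (by linarith : 0 ≤ σ * Real.sin (2 * i * η)) hS
  -- comparison with the next vertex
  have hnext : σ * Real.cos (2 * i * η + η) ≤ Real.sin (2 * i * η + η) := by
    have h := hσ _ (arc_sin_mem (t := ((i + 1 : ℕ) : ℝ)) hm hη (by positivity) (by push_cast; linarith))
    rw [hp (i + 1) him] at h
    obtain ⟨γ, hγ⟩ : ∃ γ, γ = 2 * i * η + η := ⟨_, rfl⟩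
    have e1 : 2 * ((i + 1 : ℕ) : ℝ) * η = γ + η := by rw [hγ]; push_cast; ring
    have e2 : 2 * i * η = γ - η := by rw [hγ]; ring
    rw [e1, e2, Real.sin_add, Real.sin_sub, Real.cos_add, Real.cos_sub] at h
    rw [← hγ]
    refine le_of_mul_le_mul_left (a := 2 * Real.sin η) ?_ (by positivity)
    linarith
  have hprev : Real.sin (2 * i * η - η) ≤ σ * Real.cos (2 * i * η - η) := by
    have h := hσ _ (arc_sin_mem (t := ((i - 1 : ℕ) : ℝ)) hm hη (by positivity)
      (by rw [Nat.cast_sub hi0]; push_cast; linarith))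
    rw [hp (i - 1) (by omega)] at h
    obtain ⟨γ, hγ⟩ : ∃ γ, γ = 2 * i * η - η := ⟨_, rfl⟩
    have e1 : 2 * ((i - 1 : ℕ) : ℝ) * η = γ - η := by
      rw [Nat.cast_sub hi0, hγ]; push_cast; ring
    have e2 : 2 * i * η = γ + η := by rw [hγ]; ring
    rw [e1, e2, Real.sin_add, Real.sin_sub, Real.cos_add, Real.cos_sub] at h
    rw [← hγ]
    refine le_of_mul_le_mul_left (a := 2 * Real.sin η) ?_ (by positivity)
    linarith
  rw [Real.sin_add, Real.cos_add] at hnext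
  rw [Real.sin_sub, Real.cos_sub] at hprev
  generalize Real.sin (2 * i * η) = S at *
  generalize Real.cos (2 * i * η) = C at *
  generalize Real.sin η = s at *
  generalize Real.cos η = c at *
  have hP : 0 < C + σ * S := by positivity
  have hw : c * (σ * C - S) / (s * (C + σ * S)) * s = c * (σ * C - S) / (C + σ * S) := by
    field_simp
  have d1 : c * C - c * (σ * C - S) / (C + σ * S) * S = c / (C + σ * S) := by
    field_simp; linear_combination hCS
  have d2 : c * S + c * (σ * C - S) / (C + σ * S) * C = c / (C + σ * S) * σ := by
    field_simp; linear_combination σ * hCS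
  -- If σ = tan φ and the circle's tangent has angle θ, the witness is tan (φ - θ) / tan η. The
  -- slopes of the previous and next chords, tan (θ - η) and tan (θ + η), bound it by -1 and 1.
  refine ⟨c * (σ * C - S) / (s * (C + σ * S)), fun _ => ⟨by omega, by omega, ⟨?_, ?_⟩, ?_, ?_⟩⟩
  · rw [le_div_iff₀ (by positivity)]; linarith
  · rw [div_le_iff₀ (by positivity)]; linarith
  · rw [hw, d1]; positivity
  · intro x hx
    rw [hw, d1, d2, mul_assoc]
    have := hσ x hx
    gcongr
    linarith

/-- The integral of the polygonal curve tangent to the circle at the given points. -/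
noncomputable def tangentIntegral (m : ℕ) (η : ℝ) : ℝ :=
  ∑ i ∈ Finset.range m, ((Real.sin (2 * (i + 1 : ℕ) * η) - Real.sin (2 * i * η))
      * ((1 - Real.cos (2 * i * η)) + (1 - Real.cos (2 * (i + 1 : ℕ) * η))) / 2
    - Real.sin η ^ 3 / Real.cos η)

lemma integral_eq_sum_sides (hm : 3 ≤ m) (hη : 2 * m * η = Real.pi / 2) {M : ℝ → ℝ}
    (hM : IsLorenzCurve M) :
    ∫ x in (0 : ℝ)..1, M x = ∑ i ∈ Finset.range m,
      ∫ x in Real.sin (2 * i * η)..Real.sin (2 * (i + 1 : ℕ) * η), M x := by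
  rw [intervalIntegral.sum_integral_adjacent_intervals (a := fun i : ℕ => Real.sin (2 * i * η))]
  · simp [hη]
  · intro k hk
    exact hM.intervalIntegrable (arc_sin_mem hm hη (by positivity) (by exact_mod_cast hk.le))
      (arc_sin_mem hm hη (by positivity) (by exact_mod_cast hk))

/-- Summing `integral_ge_side` over the sides reduces this to `sum_triangleArea`. Equality forces
every w_i = 0, so the circle's tangents themselves support the curve; the factor cos keeps the
vertical tangent at i = m in the same form. -/
lemma tangentIntegral_le (hm : m = 3 ∨ 5 ≤ m) (hη : 2 * m * η = Real.pi / 2) {M : ℝ → ℝ}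
    (hM : IsLorenzCurve M)
    (hp : ∀ k : ℕ, k ≤ m → M (Real.sin (2 * k * η)) = 1 - Real.cos (2 * k * η)) :
    tangentIntegral m η ≤ ∫ x in (0 : ℝ)..1, M x ∧
    (∫ x in (0 : ℝ)..1, M x = tangentIntegral m η → ∀ i ≤ m, ∀ x ∈ Icc (0 : ℝ) 1,
      Real.sin (2 * i * η) * (x - Real.sin (2 * i * η))
        ≤ Real.cos (2 * i * η) * (M x - (1 - Real.cos (2 * i * η)))) := by
  have hm3 : 3 ≤ m := by omega
  obtain ⟨hs, hc⟩ := arc_half_pos hm3 hη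
  obtain ⟨he1, he2⟩ := arc_tan_bound hm hη
  obtain ⟨w, w0, wm, hw⟩ := exists_supporting_directions hm3 hη hM hp
  obtain ⟨e, he⟩ : ∃ e, e = (Real.sin η / Real.cos η) ^ 2 := ⟨_, rfl⟩
  rw [← he] at he1 he2
  obtain ⟨hsum, heq⟩ := sum_triangleArea hm (by rw [he]; positivity) he1 he2 w
    (fun i hi => (hw i hi).1) w0 wm
  have side : ∀ i ∈ Finset.range m,
      (Real.sin (2 * (i + 1 : ℕ) * η) - Real.sin (2 * i * η))
        * ((1 - Real.cos (2 * i * η)) + (1 - Real.cos (2 * (i + 1 : ℕ) * η))) / 2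
      - 2 * Real.sin η ^ 3 / Real.cos η * triangleArea e (w i) (w (i + 1))
      ≤ ∫ x in Real.sin (2 * i * η)..Real.sin (2 * (i + 1 : ℕ) * η), M x := by
    intro i hi
    have hi := Finset.mem_range.1 hi
    have m1 := arc_sin_mem (t := i) hm3 hη (by positivity) (by exact_mod_cast hi.le)
    have m2 := arc_sin_mem (t := (i + 1 : ℕ)) hm3 hη (by positivity) (by exact_mod_cast hi)
    have hint := hM.intervalIntegrable m1 m2
    obtain ⟨a1, a2, a3⟩ := hw i hi.le
    obtain ⟨b1, b2, b3⟩ := hw (i + 1) hi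
    obtain ⟨γ, hγ⟩ : ∃ γ, γ = 2 * i * η + η := ⟨_, rfl⟩
    have e1 : 2 * (i : ℝ) * η = γ - η := by rw [hγ]; ring
    have e2 : 2 * ((i + 1 : ℕ) : ℝ) * η = γ + η := by rw [hγ]; push_cast; ring
    rw [e1] at m1 hint a2 a3 ⊢
    rw [e2] at m2 hint b2 b3 ⊢
    exact integral_ge_side hs hc he he1 a1 b1 hint a2 b2
      (fun x hx => a3 x ⟨m1.1.trans hx.1, hx.2.trans m2.2⟩)
      (fun x hx => b3 x ⟨m1.1.trans hx.1, hx.2.trans m2.2⟩)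
  have total := Finset.sum_le_sum side
  rw [← integral_eq_sum_sides hm3 hη hM, Finset.sum_sub_distrib, ← Finset.mul_sum] at total
  have htan : tangentIntegral m η = ∑ i ∈ Finset.range m,
      (Real.sin (2 * (i + 1 : ℕ) * η) - Real.sin (2 * i * η))
        * ((1 - Real.cos (2 * i * η)) + (1 - Real.cos (2 * (i + 1 : ℕ) * η))) / 2
      - 2 * Real.sin η ^ 3 / Real.cos η * (m / 2) := by
    rw [tangentIntegral, Finset.sum_sub_distrib]
    simp; ring
  have hk : 0 < 2 * Real.sin η ^ 3 / Real.cos η := by positivity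
  refine ⟨?_, fun hint i hi x hx => ?_⟩
  · have := mul_le_mul_of_nonneg_left hsum hk.le
    linarith
  · have hge : (m : ℝ) / 2 ≤ ∑ i ∈ Finset.range m, triangleArea e (w i) (w (i + 1)) :=
      le_of_mul_le_mul_left (by linarith) hk
    have hwi := heq (le_antisymm hsum hge) i hi
    have := (hw i hi).2.2 x hx
    simp only [hwi, zero_mul, add_zero, sub_zero, mul_assoc (Real.cos η)] at this
    exact le_of_mul_le_mul_left this hc

end Arc

/-! ### The tangent polygon -/

/-- The tangent of the unit circle with center `(0, 1)` at the point with parameter `2 * k * η`. -/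
noncomputable def tangentLine (η : ℝ) (k : ℕ) (x : ℝ) : ℝ :=
  1 - (1 - Real.sin (2 * k * η) * x) / Real.cos (2 * k * η)

/-- The abscissa of the intersection of two consecutive tangents. -/
noncomputable def knot (η : ℝ) (k : ℕ) : ℝ := Real.sin (2 * k * η + η) / Real.cos η

/-- The upper envelope of the tangents. -/
noncomputable def tangentPoly (m : ℕ) (η x : ℝ) : ℝ :=
  ∑ k ∈ Finset.range (m - 1),
    (Real.tan (2 * (k + 1 : ℕ) * η) - Real.tan (2 * k * η)) * max 0 (x - knot η k)

/-- The upper envelope of the tangents, completed by a vertical segment at `x = 1`. -/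
noncomputable def tangentCurve (m : ℕ) (η x : ℝ) : ℝ := if x < 1 then tangentPoly m η x else 1

section Arc

variable {m : ℕ} {η : ℝ}

lemma arc_cos_pos_nat (hm : 3 ≤ m) (hη : 2 * m * η = Real.pi / 2) {k : ℕ} (hk : k < m) :
    0 < Real.cos (2 * k * η) :=
  arc_cos_pos hm hη (by positivity) (by exact_mod_cast hk)

lemma arc_cos_nonneg_nat (hm : 3 ≤ m) (hη : 2 * m * η = Real.pi / 2) {k : ℕ} (hk : k ≤ m) :
    0 ≤ Real.cos (2 * k * η) :=
  arc_cos_nonneg hm hη (by positivity) (by exact_mod_cast hk)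

lemma arc_sin_nonneg_nat (hm : 3 ≤ m) (hη : 2 * m * η = Real.pi / 2) {k : ℕ} (hk : k ≤ m) :
    0 ≤ Real.sin (2 * k * η) :=
  arc_sin_nonneg hm hη (by positivity) (by exact_mod_cast hk)

lemma arc_tan_sub (hm : 3 ≤ m) (hη : 2 * m * η = Real.pi / 2) {k : ℕ} (hk : k + 1 < m) :
    Real.tan (2 * (k + 1 : ℕ) * η) - Real.tan (2 * k * η)
      = 2 * Real.sin η * Real.cos η
        / (Real.cos (2 * k * η) * Real.cos (2 * (k + 1 : ℕ) * η)) := by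
  have h1 := (arc_cos_pos_nat hm hη (k := k) (by omega)).ne'
  have h2 := (arc_cos_pos_nat hm hη hk).ne'
  rw [Real.tan_eq_sin_div_cos, Real.tan_eq_sin_div_cos, div_sub_div _ _ h2 h1,
    ← Real.sin_two_mul, mul_comm (Real.cos (2 * k * η)), ← Real.sin_sub]
  congr 2
  push_cast; ring

lemma arc_tan_sub_pos (hm : 3 ≤ m) (hη : 2 * m * η = Real.pi / 2) {k : ℕ} (hk : k + 1 < m) :
    0 < Real.tan (2 * (k + 1 : ℕ) * η) - Real.tan (2 * k * η) := by
  rw [arc_tan_sub hm hη hk]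
  have := arc_half_pos hm hη
  have h1 := arc_cos_pos_nat hm hη (k := k) (by omega)
  have h2 := arc_cos_pos_nat hm hη hk
  exact div_pos (mul_pos (mul_pos two_pos this.1) this.2) (mul_pos h1 h2)

/-- Consecutive tangents cross at the knot, the later one being steeper. Hence each tangent is a
telescoping sum of linear terms, and replacing these by their positive parts gives `tangentPoly`, a
form in which continuity and convexity are immediate. -/
lemma tangentLine_succ_sub (hm : 3 ≤ m) (hη : 2 * m * η = Real.pi / 2) {k : ℕ} (hk : k + 1 < m)
    (x : ℝ) : tangentLine η (k + 1) x - tangentLine η k x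
      = (Real.tan (2 * (k + 1 : ℕ) * η) - Real.tan (2 * k * η)) * (x - knot η k) := by
  have h1 := (arc_cos_pos_nat hm hη (k := k) (by omega)).ne'
  have h2 := (arc_cos_pos_nat hm hη hk).ne'
  obtain ⟨hs, hc⟩ := arc_half_pos hm hη
  have hsc := Real.sin_sq_add_cos_sq η
  rw [arc_tan_sub hm hη hk, tangentLine, tangentLine, knot]
  obtain ⟨γ, hγ⟩ : ∃ γ, γ = 2 * k * η + η := ⟨_, rfl⟩
  have hCS := Real.sin_sq_add_cos_sq γ
  have e1 : 2 * (k : ℝ) * η = γ - η := by rw [hγ]; ring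
  have e2 : 2 * ((k + 1 : ℕ) : ℝ) * η = γ + η := by rw [hγ]; push_cast; ring
  rw [← hγ, e2, e1]
  rw [e1] at h1
  rw [e2] at h2
  have c1 := Real.cos_sub γ η
  have c2 := Real.cos_add γ η
  have s1 := Real.sin_sub γ η
  have s2 := Real.sin_add γ η
  generalize Real.cos (γ - η) = C at *
  generalize Real.cos (γ + η) = C' at *
  field_simp
  rw [c1, c2, s1, s2]
  linear_combination (2 * x * Real.sin η * Real.cos η) * hCS

lemma tangentLine_zero (x : ℝ) : tangentLine η 0 x = 0 := by simp [tangentLine]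

lemma tangentLine_eq_sum (hm : 3 ≤ m) (hη : 2 * m * η = Real.pi / 2) {j : ℕ} (hj : j < m)
    (x : ℝ) : tangentLine η j x = ∑ k ∈ Finset.range j,
      (Real.tan (2 * (k + 1 : ℕ) * η) - Real.tan (2 * k * η)) * (x - knot η k) := by
  rw [Finset.sum_congr rfl fun k hk => (tangentLine_succ_sub hm hη
    (by have := Finset.mem_range.1 hk; omega) x).symm, Finset.sum_range_sub (fun k => tangentLine η k x), tangentLine_zero,
    sub_zero]

lemma knot_mono (hm : 3 ≤ m) (hη : 2 * m * η = Real.pi / 2) {j k : ℕ} (hjk : j < k) (hk : k < m) :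
    knot η j < knot η k := by
  obtain ⟨hs, hc⟩ := arc_half_pos hm hη
  have hη0 := arc_pos hm hη
  have hk' : (k : ℝ) + 1 ≤ m := by exact_mod_cast hk
  have hjk' : (j : ℝ) < k := by exact_mod_cast hjk
  refine div_lt_div_of_pos_right (Real.sin_lt_sin_of_lt_of_le_pi_div_two ?_ ?_ ?_) hc
  · have : 0 ≤ 2 * (j : ℝ) * η + η := by positivity
    linarith [Real.pi_pos]
  · rw [← hη]; nlinarith
  · gcongr

lemma knot_last (hm : 3 ≤ m) (hη : 2 * m * η = Real.pi / 2) : knot η (m - 1) = 1 := by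
  rw [knot, Nat.cast_sub (by omega),
    show 2 * ((m : ℝ) - (1 : ℕ)) * η + η = Real.pi / 2 - η by rw [← hη]; push_cast; ring,
    Real.sin_pi_div_two_sub, div_self (arc_half_pos hm hη).2.ne']

lemma knot_eq_left (hm : 3 ≤ m) (hη : 2 * m * η = Real.pi / 2) (k : ℕ) :
    knot η k = Real.sin (2 * k * η) + Real.sin η / Real.cos η * Real.cos (2 * k * η) := by
  have := (arc_half_pos hm hη).2.ne'
  rw [knot, Real.sin_add]
  field_simp

lemma knot_eq_right (hm : 3 ≤ m) (hη : 2 * m * η = Real.pi / 2) (k : ℕ) :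
    knot η k = Real.sin (2 * (k + 1 : ℕ) * η)
      - Real.sin η / Real.cos η * Real.cos (2 * (k + 1 : ℕ) * η) := by
  have := (arc_half_pos hm hη).2.ne'
  rw [knot, show 2 * (k : ℝ) * η + η = 2 * (k + 1 : ℕ) * η - η by push_cast; ring, Real.sin_sub]
  field_simp

lemma vertex_lt_knot (hm : 3 ≤ m) (hη : 2 * m * η = Real.pi / 2) {k : ℕ} (hk : k < m) :
    Real.sin (2 * k * η) < knot η k := by
  rw [knot_eq_left hm hη]
  obtain ⟨hs, hc⟩ := arc_half_pos hm hη
  have := arc_cos_pos_nat hm hη hk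
  have : 0 < Real.sin η / Real.cos η * Real.cos (2 * k * η) := by positivity
  linarith

lemma knot_le_vertex (hm : 3 ≤ m) (hη : 2 * m * η = Real.pi / 2) {k : ℕ} (hk : k < m) :
    knot η k ≤ Real.sin (2 * (k + 1 : ℕ) * η) := by
  rw [knot_eq_right hm hη]
  obtain ⟨hs, hc⟩ := arc_half_pos hm hη
  have := arc_cos_nonneg_nat hm hη (k := k + 1) hk
  have : 0 ≤ Real.sin η / Real.cos η * Real.cos (2 * (k + 1 : ℕ) * η) := by positivity
  linarith

/-- Between consecutive knots the hinges to the left are active and those to the right vanish. The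
left bound is conditional because tangent 0 has no left knot. -/
lemma tangentPoly_eq (hm : 3 ≤ m) (hη : 2 * m * η = Real.pi / 2) {j : ℕ} (hj : j < m) {x : ℝ}
    (h1 : ∀ k, k + 1 = j → knot η k ≤ x) (h2 : x ≤ knot η j) :
    tangentPoly m η x = tangentLine η j x := by
  rw [tangentLine_eq_sum hm hη hj, tangentPoly,
    ← Finset.sum_subset (Finset.range_subset_range.2 (by omega : j ≤ m - 1))]
  · refine Finset.sum_congr rfl fun k hk => ?_
    have hk := Finset.mem_range.1 hk
    rw [max_eq_right]
    rw [sub_nonneg]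
    rcases (Nat.succ_le_of_lt hk).eq_or_lt with h | h
    · exact h1 k h
    · exact (knot_mono hm hη (by omega : k < j - 1) (by omega)).le.trans (h1 (j - 1) (by omega))
  · intro k hk hkj
    have hk := Finset.mem_range.1 hk
    have hkj : j ≤ k := by simpa using hkj
    rw [max_eq_left, mul_zero]
    rw [sub_nonpos]
    rcases hkj.eq_or_lt with h | h
    · rwa [← h]
    · exact h2.trans (knot_mono hm hη h (by omega)).le

/-- Induction on the number of hinges: if x lies beyond the last knot, all hinges are active and the
sum is a tangent; otherwise the last hinge vanishes. -/
lemma tangentPoly_le (hm : 3 ≤ m) (hη : 2 * m * η = Real.pi / 2) {x y : ℝ}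
    (h : ∀ j < m, tangentLine η j x ≤ y) : tangentPoly m η x ≤ y := by
  suffices H : ∀ n < m, ∑ k ∈ Finset.range n,
      (Real.tan (2 * (k + 1 : ℕ) * η) - Real.tan (2 * k * η)) * max 0 (x - knot η k) ≤ y from
    H (m - 1) (by omega)
  intro n hn
  induction n with
  | zero => simpa [tangentLine_zero] using h 0 hn
  | succ n ih =>
    rcases le_total (knot η n) x with hx | hx
    · refine le_trans (le_of_eq ?_) (h (n + 1) hn)
      rw [tangentLine_eq_sum hm hη hn]
      refine Finset.sum_congr rfl fun k hk => ?_
      have hk := Finset.mem_range.1 hk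
      rw [max_eq_right]
      rw [sub_nonneg]
      rcases (Nat.le_of_lt_succ hk).eq_or_lt with h | h
      · rwa [h]
      · exact (knot_mono hm hη h (by omega)).le.trans hx
    · rw [Finset.sum_range_succ, max_eq_left (sub_nonpos.2 hx), mul_zero, add_zero]
      exact ih (by omega)

lemma continuous_tangentPoly : Continuous (tangentPoly m η) := by
  unfold tangentPoly; fun_prop

lemma convexOn_tangentPoly (hm : 3 ≤ m) (hη : 2 * m * η = Real.pi / 2) :
    ConvexOn ℝ univ (tangentPoly m η) := by
  have : tangentPoly m η = ∑ k ∈ Finset.range (m - 1), fun x =>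
      (Real.tan (2 * (k + 1 : ℕ) * η) - Real.tan (2 * k * η)) • max 0 (x - knot η k) := by
    ext x; simp [tangentPoly]
  rw [this]
  refine Finset.sum_induction _ (ConvexOn ℝ univ) (fun _ _ => ConvexOn.add)
    (convexOn_const 0 convex_univ) fun k hk => ?_
  have hk := Finset.mem_range.1 hk
  refine ConvexOn.smul (arc_tan_sub_pos hm hη (by omega)).le ?_
  exact (convexOn_const 0 convex_univ).sup ((convexOn_id convex_univ).sub
    (concaveOn_const _ convex_univ))

lemma tangentPoly_nonneg (hm : 3 ≤ m) (hη : 2 * m * η = Real.pi / 2) (x : ℝ) :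
    0 ≤ tangentPoly m η x :=
  Finset.sum_nonneg fun k hk => mul_nonneg (arc_tan_sub_pos hm hη
    (by have := Finset.mem_range.1 hk; omega)).le (le_max_left _ _)

lemma tangentLine_vertex (hm : 3 ≤ m) (hη : 2 * m * η = Real.pi / 2) {k : ℕ} (hk : k < m) :
    tangentLine η k (Real.sin (2 * k * η)) = 1 - Real.cos (2 * k * η) := by
  have h := (arc_cos_pos_nat hm hη hk).ne'
  have := Real.sin_sq_add_cos_sq (2 * k * η)
  rw [tangentLine]
  congr 1
  rw [div_eq_iff h]
  linarith

lemma cos_mul_tangentLine (hm : 3 ≤ m) (hη : 2 * m * η = Real.pi / 2) {k : ℕ} (hk : k < m)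
    (x : ℝ) : Real.cos (2 * k * η) * (tangentLine η k x - (1 - Real.cos (2 * k * η)))
      = Real.sin (2 * k * η) * (x - Real.sin (2 * k * η)) := by
  have h := (arc_cos_pos_nat hm hη hk).ne'
  have := Real.sin_sq_add_cos_sq (2 * k * η)
  rw [tangentLine]
  field_simp
  linarith

lemma tangentPoly_vertex (hm : 3 ≤ m) (hη : 2 * m * η = Real.pi / 2) {k : ℕ} (hk : k < m) :
    tangentPoly m η (Real.sin (2 * k * η)) = 1 - Real.cos (2 * k * η) := by
  rw [tangentPoly_eq hm hη hk (fun l hl => ?_) (vertex_lt_knot hm hη hk).le,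
    tangentLine_vertex hm hη hk]
  rw [← hl]
  exact knot_le_vertex hm hη (by omega)

lemma tangentPoly_one_le (hm : 3 ≤ m) (hη : 2 * m * η = Real.pi / 2) : tangentPoly m η 1 ≤ 1 :=
  tangentPoly_le hm hη fun j hj => by
    rw [tangentLine, mul_one]
    have := arc_cos_pos_nat hm hη hj
    have := Real.sin_le_one (2 * j * η)
    have : 0 ≤ (1 - Real.sin (2 * j * η)) / Real.cos (2 * j * η) := by
      apply div_nonneg <;> linarith
    linarith

lemma tangentPoly_le_tangentCurve (hm : 3 ≤ m) (hη : 2 * m * η = Real.pi / 2) {x : ℝ}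
    (hx : x ≤ 1) : tangentPoly m η x ≤ tangentCurve m η x := by
  rw [tangentCurve]
  split_ifs with h
  · exact le_rfl
  · rw [le_antisymm hx (not_lt.1 h)]; exact tangentPoly_one_le hm hη

lemma isLorenzCurve_tangentCurve (hm : 3 ≤ m) (hη : 2 * m * η = Real.pi / 2) :
    IsLorenzCurve (tangentCurve m η) where
  convexOn := by
    refine ⟨convex_Icc 0 1, fun x hx y hy a b ha hb hab => ?_⟩
    simp only [smul_eq_mul]
    have hz : a * x + b * y ≤ 1 := by nlinarith [hx.2, hy.2]
    -- Since 1 is an extreme point of [0, 1], a combination equal to 1 gives weight only to the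
    -- point 1; this disposes of the jump there.
    rcases hz.eq_or_lt with h | h
    · have hx1 : a = 0 ∨ x = 1 := by
        have : a * (1 - x) = 0 := by
          nlinarith [mul_nonneg ha (sub_nonneg.2 hx.2), mul_nonneg hb (sub_nonneg.2 hy.2)]
        rcases mul_eq_zero.1 this with h | h
        · exact Or.inl h
        · right; linarith
      have hy1 : b = 0 ∨ y = 1 := by
        have : b * (1 - y) = 0 := by
          nlinarith [mul_nonneg ha (sub_nonneg.2 hx.2), mul_nonneg hb (sub_nonneg.2 hy.2)]
        rcases mul_eq_zero.1 this with h | h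
        · exact Or.inl h
        · right; linarith
      have h1 : tangentCurve m η 1 = 1 := by simp [tangentCurve]
      rw [h, h1]
      rcases hx1 with rfl | rfl <;> rcases hy1 with rfl | rfl <;> simp_all
    · have h1 := (convexOn_tangentPoly hm hη).2 (mem_univ x) (mem_univ y) ha hb hab
      simp only [smul_eq_mul] at h1
      rw [tangentCurve, if_pos h]
      refine h1.trans ?_
      have := tangentPoly_le_tangentCurve hm hη hx.2
      have := tangentPoly_le_tangentCurve hm hη hy.2
      gcongr
  nonneg x _ := by
    rw [tangentCurve]
    split_ifs
    · exact tangentPoly_nonneg hm hη x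
    · exact zero_le_one
  map_zero := by
    rw [tangentCurve, if_pos one_pos]
    simpa using tangentPoly_vertex hm hη (k := 0) (by omega)
  map_one := by simp [tangentCurve]

lemma arc_sin_lt_one (hm : 3 ≤ m) (hη : 2 * m * η = Real.pi / 2) {k : ℕ} (hk : k < m) :
    Real.sin (2 * k * η) < 1 := by
  have h := arc_cos_pos_nat hm hη hk
  have := Real.sin_sq_add_cos_sq (2 * k * η)
  nlinarith [Real.sin_le_one (2 * k * η)]

lemma tangentCurve_vertex (hm : 3 ≤ m) (hη : 2 * m * η = Real.pi / 2) {k : ℕ} (hk : k ≤ m) :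
    tangentCurve m η (Real.sin (2 * k * η)) = 1 - Real.cos (2 * k * η) := by
  rcases hk.eq_or_lt with rfl | hk
  · rw [hη]; simp [tangentCurve]
  · rw [tangentCurve, if_pos (arc_sin_lt_one hm hη hk), tangentPoly_vertex hm hη hk]

/-- Over a side the polygon consists exactly of the two tangent edges, so the triangle bound applied
to the negated function gives the opposite inequality. -/
lemma integral_tangentPoly_side_le (hm : 3 ≤ m) (hη : 2 * m * η = Real.pi / 2) {i : ℕ}
    (hi : i < m) : ∫ x in Real.sin (2 * i * η)..Real.sin (2 * (i + 1 : ℕ) * η), tangentPoly m η x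
      ≤ (Real.sin (2 * (i + 1 : ℕ) * η) - Real.sin (2 * i * η))
        * ((1 - Real.cos (2 * i * η)) + (1 - Real.cos (2 * (i + 1 : ℕ) * η))) / 2
        - Real.sin η ^ 3 / Real.cos η := by
  obtain ⟨hs, hc⟩ := arc_half_pos hm hη
  obtain ⟨t, ht⟩ : ∃ t, t = Real.sin η / Real.cos η := ⟨_, rfl⟩
  have ht0 : 0 < t := by rw [ht]; positivity
  have k1 := knot_eq_left hm hη i
  have k2 := knot_eq_right hm hη i
  have htc : t * Real.cos η = Real.sin η := by rw [ht]; field_simp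
  have hy : Real.cos (2 * i * η) - Real.cos (2 * (i + 1 : ℕ) * η)
      = t * (Real.sin (2 * i * η) + Real.sin (2 * (i + 1 : ℕ) * η)) := by
    rw [show 2 * (i : ℝ) * η = (2 * i * η + η) - η by ring,
      show 2 * ((i + 1 : ℕ) : ℝ) * η = (2 * i * η + η) + η by push_cast; ring,
      Real.sin_add (_ + _), Real.sin_sub, Real.cos_add (_ + _), Real.cos_sub]
    linear_combination (-2 * Real.sin (2 * i * η + η)) * htc
  have hcross : Real.sin (2 * (i + 1 : ℕ) * η) * Real.cos (2 * i * η)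
      - Real.cos (2 * (i + 1 : ℕ) * η) * Real.sin (2 * i * η) = 2 * Real.sin η * Real.cos η := by
    rw [← Real.sin_sub, ← Real.sin_two_mul]
    congr 1; push_cast; ring
  rw [← ht] at k1 k2
  have c1 := arc_cos_pos_nat hm hη hi
  have c2 := arc_cos_nonneg_nat hm hη (k := i + 1) hi
  have := integral_ge_of_triangle (f := fun x => -tangentPoly m η x)
    (a := Real.sin (2 * i * η)) (b := Real.sin (2 * (i + 1 : ℕ) * η))
    (ya := -(1 - Real.cos (2 * i * η))) (yb := -(1 - Real.cos (2 * (i + 1 : ℕ) * η)))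
    (X₁ := t * Real.cos (2 * i * η)) (Y₁ := -(t * Real.sin (2 * i * η)))
    (X₂ := t * Real.cos (2 * (i + 1 : ℕ) * η)) (Y₂ := -(t * Real.sin (2 * (i + 1 : ℕ) * η)))
    (by positivity) (by positivity) (by linarith) (by linarith)
    (continuous_tangentPoly.neg.intervalIntegrable _ _) (fun x hx => by
      rw [← k1] at hx
      rw [tangentPoly_eq hm hη hi (fun l hl => ?_) hx.2]
      · linear_combination t * cos_mul_tangentLine hm hη hi x
      · refine le_trans ?_ hx.1
        rw [← hl]
        exact knot_le_vertex hm hη (by omega)) (fun x hx => by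
      rw [← k1] at hx
      -- On the last side the second tangent is x = 1, and the right-hand interval shrinks to the
      -- point 1.
      rcases (Nat.succ_le_of_lt hi).eq_or_lt with h | h
      · have e1 : 2 * ((i + 1 : ℕ) : ℝ) * η = Real.pi / 2 := by rw [← hη, ← h]
        have e2 : knot η i = 1 := by rw [← knot_last hm hη]; congr 1; omega
        rw [e1, Real.sin_pi_div_two, e2] at hx
        rw [e1]
        have : x = 1 := le_antisymm hx.2 hx.1
        simp [this]
      · rw [tangentPoly_eq hm hη h (fun l hl => ?_) (hx.2.trans (vertex_lt_knot hm hη h).le)]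
        · linear_combination t * cos_mul_tangentLine hm hη h x
        · obtain rfl : l = i := by omega
          exact hx.1)
  rw [intervalIntegral.integral_neg] at this
  have e : t ^ 2 * (2 * Real.sin η * Real.cos η) = 2 * (Real.sin η ^ 3 / Real.cos η) := by
    rw [ht]; field_simp
  rw [← hcross] at e
  linarith

lemma integral_tangentPoly_le (hm : 3 ≤ m) (hη : 2 * m * η = Real.pi / 2) :
    ∫ x in (0 : ℝ)..1, tangentPoly m η x ≤ tangentIntegral m η := by
  have h := intervalIntegral.sum_integral_adjacent_intervals (f := tangentPoly m η)
    (μ := MeasureTheory.volume)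
    (a := fun i : ℕ => Real.sin (2 * i * η)) (n := m)
    (fun k _ => continuous_tangentPoly.intervalIntegrable _ _)
  simp only [Nat.cast_zero, mul_zero, zero_mul, Real.sin_zero, hη, Real.sin_pi_div_two] at h
  rw [← h]
  exact Finset.sum_le_sum fun i hi => integral_tangentPoly_side_le hm hη (Finset.mem_range.1 hi)

lemma integral_tangentCurve :
    ∫ x in (0 : ℝ)..1, tangentCurve m η x = ∫ x in (0 : ℝ)..1, tangentPoly m η x := by
  rw [intervalIntegral.integral_of_le zero_le_one, intervalIntegral.integral_of_le zero_le_one,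
    MeasureTheory.integral_Ioc_eq_integral_Ioo, MeasureTheory.integral_Ioc_eq_integral_Ioo]
  exact MeasureTheory.setIntegral_congr_fun measurableSet_Ioo fun x hx => if_pos hx.2

/-- The tangent curve is the unique convex curve of smallest integral through the points. -/
lemma tangentCurve_unique (hm : m = 3 ∨ 5 ≤ m) (hη : 2 * m * η = Real.pi / 2) {L : ℝ → ℝ}
    (hL : IsLorenzCurve L)
    (hp : ∀ k : ℕ, k ≤ m → L (Real.sin (2 * k * η)) = 1 - Real.cos (2 * k * η))
    (hint : ∫ x in (0 : ℝ)..1, L x ≤ ∫ x in (0 : ℝ)..1, tangentCurve m η x) :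
    ∀ x ∈ Icc (0 : ℝ) 1, L x = tangentCurve m η x := by
  have hm3 : 3 ≤ m := by omega
  obtain ⟨h1, h2⟩ := tangentIntegral_le hm hη hL hp
  have h3 := integral_tangentPoly_le hm3 hη
  rw [integral_tangentCurve] at hint
  have hle : ∀ x ∈ Icc (0 : ℝ) 1, tangentPoly m η x ≤ L x := fun x hx =>
    tangentPoly_le hm3 hη fun j hj => by
      have := h2 (le_antisymm (hint.trans h3) h1) j hj.le x hx
      rw [← cos_mul_tangentLine hm3 hη hj] at this
      have := le_of_mul_le_mul_left this (arc_cos_pos_nat hm3 hη hj)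
      linarith
  -- Pointwise domination with equal integrals gives equality almost everywhere. Both functions are
  -- continuous on (0, 1), so they agree there; the endpoint values are prescribed.
  have hae : tangentPoly m η =ᵐ[MeasureTheory.volume.restrict (Ioc 0 1)] L := by
    rw [← MeasureTheory.integral_eq_iff_of_ae_le]
    · rw [← intervalIntegral.integral_of_le zero_le_one,
        ← intervalIntegral.integral_of_le zero_le_one]
      linarith
    · exact (continuous_tangentPoly.intervalIntegrable 0 1).1
    · exact (hL.intervalIntegrable (by simp) (by simp)).1
    · exact (MeasureTheory.ae_restrict_iff' measurableSet_Ioc).2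
        (Filter.Eventually.of_forall fun x hx => hle x ⟨hx.1.le, hx.2⟩)
  have heq := MeasureTheory.Measure.eqOn_open_of_ae_eq
    (MeasureTheory.ae_restrict_of_ae_restrict_of_subset Ioo_subset_Ioc_self hae) isOpen_Ioo
    continuous_tangentPoly.continuousOn (by
      have := hL.convexOn.continuousOn_interior
      rwa [interior_Icc] at this)
  intro x hx
  rcases hx.1.eq_or_lt with rfl | h0
  · rw [hL.map_zero, (isLorenzCurve_tangentCurve hm3 hη).map_zero]
  rcases hx.2.eq_or_lt with rfl | h1
  · rw [hL.map_one, (isLorenzCurve_tangentCurve hm3 hη).map_one]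
  rw [← heq ⟨h0, h1⟩, tangentCurve, if_pos h1]

end Arc

/-! ### Sides of the tangent polygon -/

section Arc

variable {m : ℕ} {η : ℝ}

lemma knot_le_one (hm : 3 ≤ m) (hη : 2 * m * η = Real.pi / 2) {k : ℕ} (hk : k < m) :
    knot η k ≤ 1 :=
  (knot_le_vertex hm hη hk).trans (Real.sin_le_one _)

lemma knot_pos (hm : 3 ≤ m) (hη : 2 * m * η = Real.pi / 2) {k : ℕ} (hk : k < m) :
    0 < knot η k :=
  (arc_sin_nonneg_nat hm hη hk.le).trans_lt (vertex_lt_knot hm hη hk)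

lemma tangentLine_eq (k : ℕ) (x : ℝ) : tangentLine η k x
    = Real.sin (2 * k * η) / Real.cos (2 * k * η) * x + (1 - 1 / Real.cos (2 * k * η)) := by
  rw [tangentLine]; ring

lemma tangentCurve_eq_tangentLine (hm : 3 ≤ m) (hη : 2 * m * η = Real.pi / 2) {j : ℕ} (hj : j < m)
    {x : ℝ} (h1 : ∀ k, k + 1 = j → knot η k ≤ x) (h2 : x ≤ knot η j) (hx : x < 1) :
    tangentCurve m η x = tangentLine η j x := by
  rw [tangentCurve, if_pos hx, tangentPoly_eq hm hη hj h1 h2]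

lemma isPolygonal_of_eqOn (hm : 3 ≤ m) (hη : 2 * m * η = Real.pi / 2) {L : ℝ → ℝ}
    (hL : ∀ x ∈ Icc (0 : ℝ) 1, L x = tangentCurve m η x) : IsPolygonal L := by
  refine ⟨m, fun j => if j = 0 then 0 else knot η (j - 1), by simp, ?_, fun j hj => ⟨?_,
    Real.sin (2 * j * η) / Real.cos (2 * j * η), 1 - 1 / Real.cos (2 * j * η), fun x hx => ?_⟩⟩
  · simp [knot_last hm hη, show m ≠ 0 by omega]
  · simp only [Nat.add_eq_zero_iff, one_ne_zero, and_false, if_false, Nat.add_sub_cancel]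
    split_ifs with h
    · exact knot_pos hm hη hj
    · exact knot_mono hm hη (by omega) hj
  · simp only [Nat.add_eq_zero_iff, one_ne_zero, and_false, if_false, Nat.add_sub_cancel] at hx
    have h0 : 0 < x := by
      refine lt_of_le_of_lt ?_ hx.1
      split_ifs with h
      · exact le_rfl
      · exact (knot_pos hm hη (by omega)).le
    have h1 : x < 1 := hx.2.trans_le (knot_le_one hm hη hj)
    rw [hL x ⟨h0.le, h1.le⟩, tangentCurve_eq_tangentLine hm hη hj (fun k hk => ?_) hx.2.le h1,
      tangentLine_eq]
    have := hx.1.le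
    rw [if_neg (by omega), ← hk, Nat.add_sub_cancel] at this
    exact this

/-- The midpoint of a chord lies to the left of the knot, where the curve is the tangent at the left
vertex. If the midpoint were on that tangent, then cos² η = 1. -/
lemma tangentCurve_midpoint_ne (hm : 3 ≤ m) (hη : 2 * m * η = Real.pi / 2) {i : ℕ} (hi : i < m) :
    tangentCurve m η ((Real.sin (2 * i * η) + Real.sin (2 * (i + 1 : ℕ) * η)) / 2)
      ≠ ((1 - Real.cos (2 * i * η)) + (1 - Real.cos (2 * (i + 1 : ℕ) * η))) / 2 := by
  obtain ⟨hs, hc⟩ := arc_half_pos hm hη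
  have hsc := Real.sin_sq_add_cos_sq η
  have l1 := vertex_lt_knot hm hη hi
  have l2 := knot_le_vertex hm hη hi
  have l3 := arc_sin_lt_one hm hη hi
  have l4 := Real.sin_le_one (2 * (i + 1 : ℕ) * η)
  have hC := arc_cos_pos_nat hm hη hi
  obtain ⟨γ, hγ⟩ : ∃ γ, γ = 2 * i * η + η := ⟨_, rfl⟩
  have hknot : knot η i = Real.sin γ / Real.cos η := by rw [knot, hγ]
  have e1 : 2 * (i : ℝ) * η = γ - η := by rw [hγ]; ring
  have e2 : 2 * ((i + 1 : ℕ) : ℝ) * η = γ + η := by rw [hγ]; push_cast; ring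
  have hmid : (Real.sin (2 * i * η) + Real.sin (2 * (i + 1 : ℕ) * η)) / 2
      = Real.sin γ * Real.cos η := by
    rw [e1, e2, Real.sin_sub, Real.sin_add]; ring
  have hmid' : ((1 - Real.cos (2 * i * η)) + (1 - Real.cos (2 * (i + 1 : ℕ) * η))) / 2
      = 1 - Real.cos γ * Real.cos η := by
    rw [e1, e2, Real.cos_sub, Real.cos_add]; ring
  have hle : Real.sin γ * Real.cos η ≤ knot η i := by
    have h0 := knot_pos hm hη hi
    have : Real.sin γ = knot η i * Real.cos η := by rw [hknot]; field_simp
    rw [this, mul_assoc]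
    exact mul_le_of_le_one_right h0.le (by nlinarith)
  have hge : ∀ k, k + 1 = i → knot η k ≤ Real.sin γ * Real.cos η := by
    intro k hk
    have := knot_le_vertex hm hη (k := k) (by omega)
    rw [hk] at this
    rw [← hmid]
    linarith
  rw [hmid', hmid, tangentCurve_eq_tangentLine hm hη hi hge hle (by rw [← hmid]; linarith),
    tangentLine]
  intro h
  have h1 : (1 - Real.sin (2 * i * η) * (Real.sin γ * Real.cos η)) / Real.cos (2 * i * η)
      = Real.cos γ * Real.cos η := by linarith
  rw [div_eq_iff hC.ne'] at h1
  have h2 : Real.cos η = Real.cos γ * Real.cos (2 * i * η) + Real.sin γ * Real.sin (2 * i * η) := by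
    rw [← Real.cos_sub, e1]; congr 1; ring
  have h3 : Real.cos η * Real.cos η = 1 := by
    nth_rewrite 1 [h2]
    linarith
  nlinarith

/-- A tangent meets the circle once: incidence means cos (2 (k - j) η) = 1, and the angle has
absolute value below 2π. -/
lemma tangentLine_vertex_eq_iff (hm : 3 ≤ m) (hη : 2 * m * η = Real.pi / 2) {j k : ℕ} (hj : j < m)
    (hk : k ≤ m) :
    1 - Real.cos (2 * k * η) = tangentLine η j (Real.sin (2 * k * η)) ↔ k = j := by
  constructor
  · intro h
    rw [tangentLine] at h
    have h1 : (1 - Real.sin (2 * j * η) * Real.sin (2 * k * η)) / Real.cos (2 * j * η)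
      = Real.cos (2 * k * η) := by linarith
    rw [div_eq_iff (arc_cos_pos_nat hm hη hj).ne'] at h1
    have h2 : Real.cos (2 * k * η - 2 * j * η) = 1 := by rw [Real.cos_sub]; linarith
    have mk := arc_mem (t := k) hm hη (by positivity) (by exact_mod_cast hk)
    have mj := arc_mem (t := j) hm hη (by positivity) (by exact_mod_cast hj.le)
    have hpi := Real.pi_pos
    rw [Real.cos_eq_one_iff_of_lt_of_lt (by linarith [mk.1, mj.2]) (by linarith [mk.2, mj.1])] at h2
    have hη0 := arc_pos hm hη
    have : (k : ℝ) = j := by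
      have : 2 * η * ((k : ℝ) - j) = 0 := by linarith
      rcases mul_eq_zero.1 this with h | h <;> linarith
    exact_mod_cast this
  · rintro rfl
    exact (tangentLine_vertex hm hη hj).symm

end Arc

/-! ### The regular polygon and the counterexamples -/

section Regular

variable {n : ℕ}

lemma regularVertex_eq (n k : ℕ) : regularVertex n k
    = (Real.sin (2 * k * (Real.pi / n)), 1 - Real.cos (2 * k * (Real.pi / n))) := by
  rw [regularVertex, show 2 * Real.pi * k / n = 2 * k * (Real.pi / n) by ring]

lemma regular_angle (hn : 4 * (n / 4) = n) (hm : 3 ≤ n / 4) :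
    2 * ((n / 4 : ℕ) : ℝ) * (Real.pi / n) = Real.pi / 2 := by
  have h : ((n / 4 : ℕ) : ℝ) * 4 = n := by rw [mul_comm]; exact_mod_cast hn
  have h0 : ((n / 4 : ℕ) : ℝ) ≠ 0 := by positivity
  rw [← h]
  field_simp
  norm_num

lemma isCircumscribed_regularArc_iff {L : ℝ → ℝ} : IsCircumscribed (regularArc n) L ↔
    IsLorenzCurve L ∧ ∀ k : ℕ, k ≤ n / 4 →
      L (Real.sin (2 * k * (Real.pi / n))) = 1 - Real.cos (2 * k * (Real.pi / n)) := by
  refine and_congr Iff.rfl ⟨fun h k hk => ?_, fun h i => ?_⟩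
  · simpa [regularArc, regularVertex_eq] using h ⟨k, Nat.lt_succ_of_le hk⟩
  · simpa [regularArc, regularVertex_eq] using h i (Nat.le_of_lt_succ i.2)

lemma isLorenzData_regularArc (hn : 4 * (n / 4) = n) (hm : 3 ≤ n / 4) :
    IsLorenzData (regularArc n) := by
  have hη := regular_angle hn hm
  have hη0 := arc_pos hm hη
  obtain ⟨hs, hc⟩ := arc_half_pos hm hη
  refine ⟨?_, ?_, fun i => ?_, fun i j hij => ?_, ?_⟩
  · simp [regularArc, regularVertex_eq]
  · simp only [regularArc, regularVertex_eq, Fin.val_last, hη]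
    simp
  · simp only [regularArc, regularVertex_eq]
    linarith [Real.cos_le_one (2 * (i : ℕ) * (Real.pi / n))]
  · simp only [regularArc, regularVertex_eq]
    have mi := arc_mem (t := (i : ℕ)) hm hη (by positivity)
      (by exact_mod_cast Nat.le_of_lt_succ i.2)
    have mj := arc_mem (t := (j : ℕ)) hm hη (by positivity)
      (by exact_mod_cast Nat.le_of_lt_succ j.2)
    refine Real.sin_lt_sin_of_lt_of_le_pi_div_two (by linarith [mi.1, Real.pi_pos]) mj.2 ?_
    have : ((i : ℕ) : ℝ) < (j : ℕ) := by exact_mod_cast hij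
    gcongr
  · have mem : ∀ i : Fin (n / 4), 2 * (i : ℕ) * (Real.pi / n) + Real.pi / n
        ∈ Ioo (-(Real.pi / 2)) (Real.pi / 2) := by
      intro i
      have hi : ((i : ℕ) : ℝ) + 1 ≤ (n / 4 : ℕ) := by exact_mod_cast i.2
      constructor
      · have : 0 ≤ 2 * ((i : ℕ) : ℝ) * (Real.pi / n) + Real.pi / n := by positivity
        linarith [Real.pi_pos]
      · rw [← hη]; nlinarith
    have slope : ∀ i : Fin (n / 4), sideSlope (regularArc n) i
        = Real.tan (2 * (i : ℕ) * (Real.pi / n) + Real.pi / n) := by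
      intro i
      have hC := Real.cos_pos_of_mem_Ioo (mem i)
      simp only [sideSlope, regularArc, regularVertex_eq, Fin.val_succ, Fin.val_castSucc]
      rw [Real.tan_eq_sin_div_cos]
      generalize Real.pi / n = η at *
      obtain ⟨γ, hγ⟩ : ∃ γ, γ = 2 * (i : ℕ) * η + η := ⟨_, rfl⟩
      have e1 : 2 * ((i : ℕ) : ℝ) * η = γ - η := by rw [hγ]; ring
      have e2 : 2 * (((i : ℕ) + 1 : ℕ) : ℝ) * η = γ + η := by rw [hγ]; push_cast; ring
      rw [← hγ] at hC ⊢
      rw [e1, e2, Real.sin_sub, Real.sin_add, Real.cos_sub, Real.cos_add,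
        show 1 - (Real.cos γ * Real.cos η - Real.sin γ * Real.sin η)
          - (1 - (Real.cos γ * Real.cos η + Real.sin γ * Real.sin η))
          = Real.sin γ * (2 * Real.sin η) by ring,
        show Real.sin γ * Real.cos η + Real.cos γ * Real.sin η
          - (Real.sin γ * Real.cos η - Real.cos γ * Real.sin η)
          = Real.cos γ * (2 * Real.sin η) by ring,
        mul_div_mul_right _ _ (by positivity)]
    intro i j hij
    rw [slope, slope]
    refine Real.strictMonoOn_tan (mem i) (mem j) ?_
    have : ((i : ℕ) : ℝ) < (j : ℕ) := by exact_mod_cast hij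
    gcongr

lemma isOptimal_tangentCurve (hn : 4 * (n / 4) = n) (hm : n / 4 = 3 ∨ 5 ≤ n / 4) :
    IsOptimal (regularArc n) (tangentCurve (n / 4) (Real.pi / n)) := by
  have hm3 : 3 ≤ n / 4 := by omega
  have hη := regular_angle hn hm3
  have hL := isLorenzCurve_tangentCurve hm3 hη
  refine ⟨isCircumscribed_regularArc_iff.2 ⟨hL, fun k hk => tangentCurve_vertex hm3 hη hk⟩,
    fun M hM => ?_⟩
  obtain ⟨hM, hMp⟩ := isCircumscribed_regularArc_iff.1 hM
  rw [gini_eq hM, gini_eq hL, integral_tangentCurve]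
  have := (tangentIntegral_le hm hη hM hMp).1
  have := integral_tangentPoly_le hm3 hη
  linarith

lemma IsOptimal.eq_tangentCurve (hn : 4 * (n / 4) = n) (hm : n / 4 = 3 ∨ 5 ≤ n / 4) {L : ℝ → ℝ}
    (hL : IsOptimal (regularArc n) L) :
    ∀ x ∈ Icc (0 : ℝ) 1, L x = tangentCurve (n / 4) (Real.pi / n) x := by
  have hm3 : 3 ≤ n / 4 := by omega
  have hη := regular_angle hn hm3
  obtain ⟨hLc, hLp⟩ := isCircumscribed_regularArc_iff.1 hL.1
  refine tangentCurve_unique hm hη hLc hLp ?_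
  have := hL.2 _ (isOptimal_tangentCurve hn hm).1
  rw [gini_eq hLc, gini_eq (isLorenzCurve_tangentCurve hm3 hη)] at this
  linarith

lemma IsOptimal.not_used (hn : 4 * (n / 4) = n) (hm : n / 4 = 3 ∨ 5 ≤ n / 4) {L : ℝ → ℝ}
    (hL : IsOptimal (regularArc n) L) (i : Fin (n / 4)) : ¬ Used (regularArc n) L i := by
  have hm3 : 3 ≤ n / 4 := by omega
  have hη := regular_angle hn hm3
  intro hu
  have h := hu (midpoint_mem_segment _ _)
  simp only [midpoint_eq_smul_add, regularArc, regularVertex_eq, Fin.val_succ, Fin.val_castSucc,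
    mem_ofPred_eq, Prod.snd_add, Prod.fst_add, Prod.smul_fst, Prod.smul_snd, smul_eq_mul,
    invOf_eq_inv] at h
  have m1 := arc_sin_mem (t := (i : ℕ)) hm3 hη (by positivity) (by exact_mod_cast i.2.le)
  have m2 := arc_sin_mem (t := ((i : ℕ) + 1 : ℕ)) hm3 hη (by positivity) (by exact_mod_cast i.2)
  rw [hL.eq_tangentCurve hn hm _ ⟨by linarith [m1.1, m2.1], by linarith [m1.2, m2.2]⟩,
    inv_mul_eq_div, inv_mul_eq_div] at h
  exact tangentCurve_midpoint_ne hm3 hη i.2 h.symm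

lemma IsOptimal.not_sidesOnSidelines (hn : 4 * (n / 4) = n) (hm : n / 4 = 3 ∨ 5 ≤ n / 4)
    {L : ℝ → ℝ} (hL : IsOptimal (regularArc n) L) : ¬ SidesOnSidelines (regularArc n) L := by
  have hm3 : 3 ≤ n / 4 := by omega
  have hη := regular_angle hn hm3
  intro h
  have k0 := knot_pos hm3 hη (k := 0) (by omega)
  have k1 := knot_le_one hm3 hη (k := 1) (by omega)
  -- The side between the first two knots lies on the tangent at p_1, which has positive slope and
  -- contains no other given point.
  rcases h (knot (Real.pi / n) 0) (knot (Real.pi / n) 1) _ _ k0.le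
    (knot_mono hm3 hη zero_lt_one (by omega)) k1 (fun x hx => by
      have hx1 := hx.2.trans_le k1
      rw [hL.eq_tangentCurve hn hm x ⟨(k0.trans hx.1).le, hx1.le⟩,
        tangentCurve_eq_tangentLine hm3 hη (j := 1) (by omega) (fun k hk => ?_) hx.2.le hx1,
        tangentLine_eq]
      obtain rfl : k = 0 := by omega
      exact hx.1.le) with ⟨h0, -⟩ | ⟨i, hi, hi'⟩
  · have hS := arc_sin_pos (t := (1 : ℕ)) hm3 hη (by simp) (by exact_mod_cast (by omega))
    have hC := arc_cos_pos_nat hm3 hη (k := 1) (by omega)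
    exact (div_pos hS hC).ne' h0
  · rw [← tangentLine_eq] at hi hi'
    simp only [regularArc, regularVertex_eq, Fin.val_succ, Fin.val_castSucc] at hi hi'
    rw [tangentLine_vertex_eq_iff hm3 hη (by omega) i.2.le] at hi
    rw [tangentLine_vertex_eq_iff hm3 hη (by omega) i.2] at hi'
    omega

lemma regularVertex_mod (hn : 0 < n) (k : ℕ) : regularVertex n (k % n) = regularVertex n k := by
  have h : 2 * Real.pi * k / n = 2 * Real.pi * (k % n : ℕ) / n + (k / n : ℕ) * (2 * Real.pi) := by
    have : (k : ℝ) = (n : ℝ) * (k / n : ℕ) + (k % n : ℕ) := by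
      exact_mod_cast (Nat.div_add_mod k n).symm
    have hn' : (n : ℝ) ≠ 0 := by positivity
    rw [this]
    field_simp
    ring
  simp only [regularVertex, h, Real.sin_add_nat_mul_two_pi, Real.cos_add_nat_mul_two_pi]

lemma range_regularVertex_inter (hn : 4 * (n / 4) = n) (hm : 3 ≤ n / 4) :
    range (regularVertex n) ∩ Icc ((0, 0) : ℝ × ℝ) (1, 1) = range (regularArc n) := by
  have hη := regular_angle hn hm
  have hn0 : 0 < n := by omega
  have hη0 := arc_pos hm hη
  have hnη : 2 * (n : ℝ) * (Real.pi / n) = 2 * Real.pi := by field_simp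
  apply Subset.antisymm
  · rintro _ ⟨⟨k, rfl⟩, h⟩
    rw [← regularVertex_mod hn0] at h ⊢
    have hr : k % n < n := Nat.mod_lt _ hn0
    generalize k % n = r at *
    have hr' : (r : ℝ) < n := by exact_mod_cast hr
    by_cases hr4 : r ≤ n / 4
    · exact ⟨⟨r, Nat.lt_succ_of_le hr4⟩, rfl⟩
    exfalso
    rw [regularVertex_eq, mem_Icc, Prod.mk_le_mk, Prod.mk_le_mk] at h
    obtain ⟨⟨h1, -⟩, -, h2⟩ := h
    have hr5 : ((n / 4 : ℕ) : ℝ) < r := by exact_mod_cast not_le.1 hr4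
    have l1 : Real.pi / 2 < 2 * r * (Real.pi / n) := by rw [← hη]; gcongr
    have l2 : 2 * r * (Real.pi / n) < 2 * Real.pi := by rw [← hnη]; gcongr
    -- A later vertex has angle in (π/2, 3π/2), hence y > 1, or in [3π/2, 2π), hence x < 0.
    rcases lt_or_ge (2 * r * (Real.pi / n)) (Real.pi + Real.pi / 2) with h3 | h3
    · have := Real.cos_neg_of_pi_div_two_lt_of_lt l1 h3
      linarith
    · have := Real.sin_neg_of_neg_of_neg_pi_lt (x := 2 * r * (Real.pi / n) - 2 * Real.pi)
        (by linarith) (by linarith [Real.pi_pos])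
      rw [Real.sin_sub_two_pi] at this
      linarith
  · rintro _ ⟨i, rfl⟩
    refine ⟨⟨i, rfl⟩, ?_⟩
    have hi := Nat.le_of_lt_succ i.2
    rw [regularArc, regularVertex_eq, mem_Icc, Prod.mk_le_mk, Prod.mk_le_mk]
    have := arc_sin_nonneg_nat hm hη hi
    have := arc_cos_nonneg_nat hm hη hi
    have := Real.sin_le_one (2 * (i : ℕ) * (Real.pi / n))
    have := Real.cos_le_one (2 * (i : ℕ) * (Real.pi / n))
    refine ⟨⟨?_, ?_⟩, ?_, ?_⟩ <;> linarith

lemma regularArc_optimal {n : ℕ} (h5 : 5 ≤ n) (h8 : 8 ∣ n - 4) :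
    range (regularVertex n) ∩ Icc ((0, 0) : ℝ × ℝ) (1, 1) = range (regularArc n) ∧
      IsLorenzData (regularArc n) ∧
      (∃ L : ℝ → ℝ, IsOptimal (regularArc n) L) ∧
      ∀ L : ℝ → ℝ, IsOptimal (regularArc n) L →
        IsPolygonal L ∧ (∀ i, ¬ Used (regularArc n) L i) ∧
        HasConsecutiveN (regularArc n) L ∧ ¬ SidesOnSidelines (regularArc n) L := by
  have hn : 4 * (n / 4) = n := by omega
  -- Divisibility makes n / 4 odd, and n ≥ 5 excludes n / 4 = 1.
  have hm : n / 4 = 3 ∨ 5 ≤ n / 4 := by omega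
  have hm3 : 3 ≤ n / 4 := by omega
  refine ⟨range_regularVertex_inter hn hm3, isLorenzData_regularArc hn hm3,
    ⟨_, isOptimal_tangentCurve hn hm⟩, fun L hL => ⟨?_, hL.not_used hn hm, ?_,
    hL.not_sidesOnSidelines hn hm⟩⟩
  · exact isPolygonal_of_eqOn hm3 (regular_angle hn hm3) (hL.eq_tangentCurve hn hm)
  · exact ⟨⟨0, by omega⟩, ⟨1, by omega⟩, rfl, hL.not_used hn hm _, hL.not_used hn hm _⟩

end Regular

theorem mainTheorem7 :
    ¬ FarrisConjectureSidelines ∧ ¬ FarrisConjectureSequences ∧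
    ∀ n : ℕ, 5 ≤ n → 8 ∣ n - 4 →
      range (regularVertex n) ∩ Icc ((0, 0) : ℝ × ℝ) (1, 1) = range (regularArc n) ∧
      IsLorenzData (regularArc n) ∧
      (∃ L : ℝ → ℝ, IsOptimal (regularArc n) L) ∧
      ∀ L : ℝ → ℝ, IsOptimal (regularArc n) L →
        IsPolygonal L ∧ (∀ i, ¬ Used (regularArc n) L i) ∧
        HasConsecutiveN (regularArc n) L ∧ ¬ SidesOnSidelines (regularArc n) L := by
  obtain ⟨-, hdata, -, hopt⟩ := regularArc_optimal (n := 12) (by norm_num) (by norm_num)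
  refine ⟨fun h => ?_, fun h => ?_, fun n => regularArc_optimal⟩
  · obtain ⟨L, hL, -, hside⟩ := h _ _ hdata
    exact (hopt L hL).2.2.2 hside
  · obtain ⟨L, hL, -, hseq⟩ := h _ _ hdata
    exact hseq (hopt L hL).2.2.1
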